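/- Let $\mathbb K$ be a field, $d\ge 0$ an integer, $V$ a $\mathbb K$-vector space of dimension $d+1$; index the rows and columns of matrices in $\mathrm{Mat}_{d+1}(\mathbb K)$ by $0,\dots,d$. **TH systems.** An element of $\mathrm{End}(V)$ is multiplicity-free if it is diagonalizable with all eigenspaces of dimension one; its primitive idempotents are the projections onto its eigenspaces along the sum of the others. A TH system on $V$ is a sequence $\Phi=(A;\{E_i\}_{i=0}^d;A^*;\{E_i^*\}_{i=0}^d)$ where $A,A^*\in\mathrm{End}(V)$ are multiplicity-free, $\{E_i\}$ (resp. $\{E^*_i\}$) is an ordering of the primitive idempotents of $A$ (resp. $A^*$), and both $E_iA^*E_j$ and $E^*_iAE^*_j$ are zero if $i-j>1$ and nonzero if $i-j=1$. Let $\theta_i$ (resp. $\theta^*_i$) be the eigenvalue of $A$ (resp. $A^*$) for $E_i$ (resp. $E_i^*$). The relatives of $\Phi$ are $\Phi$, $\Phi^*=(A^*;\{E^*_i\};A;\{E_i\})$, $\tilde\Phi=(A^\sigma;\{E_{d-i}^\sigma\};A^{*\sigma};\{E_{d-i}^{*\sigma}\})$ and $\tilde\Phi^*=(\tilde\Phi)^*$,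 where $\sigma:\mathrm{End}(V)\to\mathrm{End}(\tilde V)$ is the transpose, $\tilde V$ the dual space. For an object $f$ attached to $\Phi$, write $f^*,\tilde f,\tilde f^*$ for the same object attached to $\Phi^*,\tilde\Phi,\tilde\Phi^*$. **Objects attached to $\Phi$.** Fix $0\ne\xi_0\in E_0V$ (nothing below depends on the choice). * $P$ is the transition matrix from the basis $\{E_iE^*_0\xi_0\}_{i=0}^d$ to the basis $\{E^*_i\xi_0\}_{i=0}^d$, that is, $E_j^*\xi_0=\sum_i P_{ij}E_iE_0^*\xi_0$. * $H$ is the (Hessenberg) matrix representing $A$ in the basis $\{E_i^*\xi_0\}$, $c_H=\prod_{i=1}^dH_{i,i-1}$, and $s_0,\dots,s_{d+1}\in\mathbb K[\lambda]$ are given by $s_0=1$, $\lambda s_j=\sum_{i=0}^{j+1}H_{ij}s_i$ for $0\le j<d$, and $\lambda s_d=c_H^{-1}s_{d+1}+\sum_{i=0}^dH_{id}s_i$. * $\ell_i=\prod_{j\neq 0}(\theta^*_0-\theta^*_j)\big/\prod_{j\ne i}(\theta^*_i-\theta^*_j)$, $L=\mathrm{diag}(\ell_0,\dots,\ell_d)$;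 $t_i=s_i/\ell_i$ for $0\le i\le d$ and $t_{d+1}=s_{d+1}$. * For $1\le i\le d$, $\varphi_i$ is the eigenvalue of $(A-\theta_{d-i+1}I)(A^*-\theta_i^*I)$ on the line $U_i=(E_0^*V+\dots+E^*_iV)\cap(E_0V+\dots+E_{d-i}V)$. The matrix $\mathcal P$ has entries $\mathcal P_{ij}=p(\theta_i,\theta_j^*)$, where $p(\lambda,\mu)=\sum_{h=0}^d\frac{\prod_{k<h}(\lambda-\theta_{d-k})\prod_{k<h}(\mu-\theta^*_k)}{\varphi_1\cdots\varphi_h}$. **Vandermonde systems.** A sequence of polynomials $f_0,\dots,f_d$ is graded if $f_0=1$ and $\deg f_i=i$. A matrix $X$ is west Vandermonde if all $X_{i0}\ne0$ and there are distinct scalars $\vartheta_0,\dots,\vartheta_d$ and a graded sequence $\{f_i\}_{i=0}^d$ with $X_{ij}=X_{i0}f_j(\vartheta_i)$ for all $i,j$; then $(X,\{\vartheta_i\})$ is a west Vandermonde system, and its polynomials are $f_0,\dots,f_d$ (which are unique) together with $f_{d+1}=\prod_{i=0}^d(\lambda-\vartheta_i)$. $X$ is south Vandermonde, resp. $(X,\{\vartheta_i\})$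 is a south Vandermonde system with polynomials $\{f_i\}$, if the same holds for the matrix obtained by rotating $X$ clockwise by $90$ degrees (so $X_{ij}=X_{dj}f_{d-i}(\vartheta_j)$). $X$ is double Vandermonde if it is both west and south Vandermonde. **Proposition.** For every TH system $\Phi$: 1. The following are west Vandermonde systems with the indicated polynomials (indices of polynomials $0\le i\le d+1$): $(P,\{\theta_i\})$ with $\{s_i\}$; $(P^*,\{\theta^*_i\})$ with $\{s^*_i\}$; $(\tilde P,\{\theta_{d-i}\})$ with $\{\tilde s_i\}$; $(\tilde P^*,\{\theta^*_{d-i}\})$ with $\{\tilde s_i^*\}$. 2. The following are south Vandermonde systems with the indicated polynomials: $(P,\{\theta^*_i\})$ with $\{\tilde t^*_i\}$; $(P^*,\{\theta_i\})$ with $\{\tilde t_i\}$; $(\tilde P,\{\theta^*_{d-i}\})$ with $\{t^*_i\}$; $(\tilde P^*,\{\theta_{d-i}\})$ with $\{t_i\}$. 3. $L$ is invertible and $\mathcal P=PL^{-1}$, and likewise for the relatives of $\Phi$. 4. The following are west Vandermonde systems with the indicated polynomials: $(\mathcal P,\{\theta_i\})$ with $\{t_i\}$; $(\mathcal P^*,\{\theta^*_i\})$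 with $\{t^*_i\}$; $(\tilde{\mathcal P},\{\theta_{d-i}\})$ with $\{\tilde t_i\}$; $(\tilde{\mathcal P}^*,\{\theta^*_{d-i}\})$ with $\{\tilde t_i^*\}$. 5. The following are south Vandermonde systems with the indicated polynomials: $(\mathcal P,\{\theta^*_i\})$ with $\{\tilde t^*_i\}$; $(\mathcal P^*,\{\theta_i\})$ with $\{\tilde t_i\}$; $(\tilde{\mathcal P},\{\theta^*_{d-i}\})$ with $\{t^*_i\}$; $(\tilde{\mathcal P}^*,\{\theta_{d-i}\})$ with $\{t_i\}$. 6. Consequently $P,P^*,\tilde P,\tilde P^*$ and $\mathcal P,\mathcal P^*,\tilde{\mathcal P},\tilde{\mathcal P}^*$ are double Vandermonde. -/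

import Mathlib

open Polynomial

noncomputable section

/-! ## Multiplicity-free maps and their primitive idempotents -/

/-- `A` is diagonalizable and each of its eigenspaces has dimension one. -/
def IsMultiplicityFree {K V : Type*} [Field K] [AddCommGroup V] [Module K V]
    (A : Module.End K V) : Prop :=
  (⨆ μ : K, A.eigenspace μ) = ⊤ ∧
    ∀ μ : K, A.HasEigenvalue μ → Module.finrank K (A.eigenspace μ) = 1

/-- `E` is the primitive idempotent of `A` for the eigenvalue `θ`: it is the identity on the
`θ`-eigenspace and zero on every other eigenspace. -/
structure IsPrimitiveIdempotent {K V : Type*} [Field K] [AddCommGroup V] [Module K V]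
    (A E : Module.End K V) (θ : K) : Prop where
  hasEigenvalue : A.HasEigenvalue θ
  apply_self : ∀ v ∈ A.eigenspace θ, E v = v
  apply_other : ∀ μ : K, μ ≠ θ → ∀ v ∈ A.eigenspace μ, E v = 0

/-- `E 0, …, E d` is an ordering of the primitive idempotents of `A`, and `θ 0, …, θ d` is the
corresponding ordering of the eigenvalues of `A`. -/
structure IsIdempotentOrdering {K V : Type*} [Field K] [AddCommGroup V] [Module K V] {d : ℕ}
    (A : Module.End K V) (E : Fin (d + 1) → Module.End K V) (θ : Fin (d + 1) → K) : Prop where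
  injective : Function.Injective θ
  primitive : ∀ i, IsPrimitiveIdempotent A (E i) (θ i)
  exhaust : ∀ μ : K, A.HasEigenvalue μ → ∃ i, θ i = μ

section Idempotents

variable {K V : Type*} [Field K] [AddCommGroup V] [Module K V] {d : ℕ}
  {A : Module.End K V} {E : Fin (d + 1) → Module.End K V} {θ : Fin (d + 1) → K}

theorem IsIdempotentOrdering.ext_end (hA : IsMultiplicityFree A) (h : IsIdempotentOrdering A E θ)
    {S T : Module.End K V} (H : ∀ i, ∀ v ∈ A.eigenspace (θ i), S v = T v) : S = T := by
  ext v
  have hv : v ∈ (⨆ μ : K, A.eigenspace μ) := by rw [hA.1]; trivial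
  induction hv using Submodule.iSup_induction' with
  | mem μ x hx =>
    by_cases h0 : x = 0
    · simp [h0]
    · obtain ⟨i, rfl⟩ := h.exhaust μ (Module.End.hasEigenvalue_of_hasEigenvector ⟨hx, h0⟩)
      exact H i x hx
  | zero => simp
  | add x y _ _ hx hy => simp [hx, hy]

theorem IsIdempotentOrdering.apply_eigen (h : IsIdempotentOrdering A E θ) (i j : Fin (d + 1))
    (v : V) (hv : v ∈ A.eigenspace (θ j)) : E i v = if i = j then v else 0 := by
  split_ifs with hij
  · subst hij; exact (h.primitive i).apply_self v hv
  · exact (h.primitive i).apply_other _ (fun e => hij (h.injective e).symm) v hv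

theorem IsIdempotentOrdering.sum_eq_one (hA : IsMultiplicityFree A)
    (h : IsIdempotentOrdering A E θ) : ∑ i, E i = 1 := by
  refine h.ext_end hA fun j v hv => ?_
  simp [LinearMap.sum_apply, h.apply_eigen _ j v hv]

theorem IsIdempotentOrdering.mul_eq (hA : IsMultiplicityFree A)
    (h : IsIdempotentOrdering A E θ) (i j : Fin (d + 1)) :
    E i * E j = if i = j then E i else 0 := by
  refine h.ext_end hA fun k v hv => ?_
  rw [Module.End.mul_apply, h.apply_eigen j k v hv]
  by_cases hij : i = j
  · subst hij
    by_cases hik : i = k <;> simp [hik, h.apply_eigen _ k v hv]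
  · by_cases hjk : j = k
    · subst hjk; simp [hij, h.apply_eigen _ _ v hv]
    · simp [hij, hjk]

theorem IsIdempotentOrdering.map_mul (hA : IsMultiplicityFree A)
    (h : IsIdempotentOrdering A E θ) (i : Fin (d + 1)) : A * E i = θ i • E i := by
  refine h.ext_end hA fun k v hv => ?_
  rw [Module.End.mul_apply, LinearMap.smul_apply, h.apply_eigen i k v hv]
  split_ifs with hik
  · subst hik; exact Module.End.mem_eigenspace_iff.1 hv
  · simp

theorem IsIdempotentOrdering.mul_map (hA : IsMultiplicityFree A)
    (h : IsIdempotentOrdering A E θ) (i : Fin (d + 1)) : E i * A = θ i • E i := by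
  refine h.ext_end hA fun k v hv => ?_
  rw [Module.End.mul_apply, LinearMap.smul_apply, Module.End.mem_eigenspace_iff.1 hv, _root_.map_smul,
    h.apply_eigen i k v hv]
  split_ifs with hik
  · rw [hik]
  · simp

theorem IsIdempotentOrdering.range_eq (hA : IsMultiplicityFree A)
    (h : IsIdempotentOrdering A E θ) (i : Fin (d + 1)) :
    LinearMap.range (E i) = A.eigenspace (θ i) := by
  ext v
  constructor
  · rintro ⟨w, rfl⟩
    rw [Module.End.mem_eigenspace_iff, ← Module.End.mul_apply, h.map_mul hA]
    rfl
  · intro hv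
    exact ⟨v, (h.primitive i).apply_self v hv⟩

theorem IsIdempotentOrdering.finrank_range (hA : IsMultiplicityFree A)
    (h : IsIdempotentOrdering A E θ) (i : Fin (d + 1)) :
    Module.finrank K (LinearMap.range (E i)) = 1 := by
  rw [h.range_eq hA]
  exact hA.2 _ (h.primitive i).hasEigenvalue

theorem isIdempotentOrdering_of_relations (hθ : Function.Injective θ) (hsum : ∑ i, E i = 1)
    (hAE : ∀ i, A * E i = θ i • E i)
    (hEA : ∀ i, E i * A = θ i • E i) (hrank : ∀ i, Module.finrank K (LinearMap.range (E i)) = 1) :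
    IsMultiplicityFree A ∧ IsIdempotentOrdering A E θ := by
  have hdec : ∀ v : V, ∑ i, E i v = v := fun v => by
    have := LinearMap.congr_fun hsum v
    simpa [LinearMap.sum_apply] using this
  have hkill : ∀ (μ : K) (v : V), v ∈ A.eigenspace μ → ∀ i, θ i ≠ μ → E i v = 0 := by
    intro μ v hv i hi
    have h1 := LinearMap.congr_fun (hEA i) v
    rw [Module.End.mul_apply, Module.End.mem_eigenspace_iff.1 hv, _root_.map_smul,
      LinearMap.smul_apply] at h1
    have h2 : (θ i - μ) • E i v = 0 := by rw [sub_smul, h1, sub_self]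
    exact (smul_eq_zero.1 h2).resolve_left (sub_ne_zero.2 hi)
  have hfix : ∀ i, ∀ v ∈ A.eigenspace (θ i), E i v = v := by
    intro i v hv
    have h1 := hdec v
    rwa [Finset.sum_eq_single i (fun j _ hj => hkill _ v hv j (fun e => hj (hθ e)))
      (by simp)] at h1
  have hrange : ∀ i, LinearMap.range (E i) = A.eigenspace (θ i) := by
    intro i
    ext v
    constructor
    · rintro ⟨w, rfl⟩
      rw [Module.End.mem_eigenspace_iff, ← Module.End.mul_apply, hAE]
      rfl
    · intro hv
      exact ⟨v, hfix i v hv⟩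
  have hex : ∀ μ : K, A.HasEigenvalue μ → ∃ i, θ i = μ := by
    intro μ hμ
    obtain ⟨v, hv, hv0⟩ := hμ.exists_hasEigenvector
    by_contra hne
    push Not at hne
    apply hv0
    rw [← hdec v]
    exact Finset.sum_eq_zero fun i _ => hkill μ v hv i (hne i)
  refine ⟨⟨?_, ?_⟩, hθ, fun i => ⟨?_, hfix i, fun μ hμ v hv => hkill μ v hv i hμ.symm⟩, hex⟩
  · rw [eq_top_iff]
    intro v _
    rw [← hdec v]
    refine Submodule.sum_mem _ fun i _ => ?_
    refine Submodule.mem_iSup_of_mem (θ i) ?_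
    rw [← hrange i]
    exact ⟨v, rfl⟩
  · intro μ hμ
    obtain ⟨i, rfl⟩ := hex μ hμ
    rw [← hrange i]
    exact hrank i
  · intro h0
    have h1 := hrank i
    rw [hrange i] at h1
    have h2 : A.eigenspace (θ i) = ⊥ := by simpa [Module.End.eigenspace] using h0
    rw [h2] at h1
    simp at h1

/-- The reversed transposes of the primitive idempotents are the primitive idempotents of the
transpose. -/
theorem IsIdempotentOrdering.dual (hA : IsMultiplicityFree A) [FiniteDimensional K V]
    (h : IsIdempotentOrdering A E θ) :
    IsMultiplicityFree (V := Module.Dual K V) A.dualMap ∧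
      IsIdempotentOrdering (V := Module.Dual K V) A.dualMap (fun i => (E i.rev).dualMap)
        (fun i => θ i.rev) := by
  have hm : ∀ S T : Module.End K V,
      ((S.dualMap : Module.End K (Module.Dual K V)) * T.dualMap) = (T * S).dualMap := fun _ _ => rfl
  have hs : ∀ (c : K) (S : Module.End K V), (c • S).dualMap = c • S.dualMap := fun c S =>
    _root_.map_smul (Module.Dual.transpose (R := K) (M := V) (M' := V)) c S
  refine isIdempotentOrdering_of_relations (h.injective.comp Fin.rev_injective) ?_ ?_ ?_ ?_
  · refine (Equiv.sum_comp Fin.revPerm (fun i => (E i).dualMap)).trans ?_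
    have h1 := map_sum (Module.Dual.transpose (R := K) (M := V) (M' := V)) E Finset.univ
    rw [h.sum_eq_one hA] at h1
    exact h1.symm
  · intro i
    rw [hm, h.mul_map hA, hs]
  · intro i
    rw [hm, h.map_mul hA, hs]
  · intro i
    rw [LinearMap.finrank_range_dualMap_eq_finrank_range]
    exact h.finrank_range hA _

end Idempotents

/-! ## Thin Hessenberg systems and their relatives -/

/-- A thin Hessenberg system `(A; E 0, …, E d; As; Es 0, …, Es d)` of diameter `d` on `V`. -/
structure THSystem (K : Type*) (V : Type*) [Field K] [AddCommGroup V] [Module K V] (d : ℕ) where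
  A : Module.End K V
  E : Fin (d + 1) → Module.End K V
  As : Module.End K V
  Es : Fin (d + 1) → Module.End K V
  finrank_eq : Module.finrank K V = d + 1
  A_multFree : IsMultiplicityFree A
  As_multFree : IsMultiplicityFree As
  E_ordering : ∃ θ : Fin (d + 1) → K, IsIdempotentOrdering A E θ
  Es_ordering : ∃ θ : Fin (d + 1) → K, IsIdempotentOrdering As Es θ
  E_As_zero : ∀ i j : Fin (d + 1), j.val + 1 < i.val → E i * As * E j = 0
  E_As_ne_zero : ∀ i j : Fin (d + 1), i.val = j.val + 1 → E i * As * E j ≠ 0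
  Es_A_zero : ∀ i j : Fin (d + 1), j.val + 1 < i.val → Es i * A * Es j = 0
  Es_A_ne_zero : ∀ i j : Fin (d + 1), i.val = j.val + 1 → Es i * A * Es j ≠ 0

namespace THSystem

variable {K V : Type*} [Field K] [AddCommGroup V] [Module K V] {d : ℕ}

theorem finiteDimensional (Φ : THSystem K V d) : FiniteDimensional K V :=
  Module.finite_of_finrank_pos (by rw [Φ.finrank_eq]; omega)

/-- The eigenvalue sequence. -/
def θ (Φ : THSystem K V d) : Fin (d + 1) → K := Φ.E_ordering.choose

/-- The dual eigenvalue sequence. -/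
def θs (Φ : THSystem K V d) : Fin (d + 1) → K := Φ.Es_ordering.choose

theorem θ_spec (Φ : THSystem K V d) : IsIdempotentOrdering Φ.A Φ.E Φ.θ := Φ.E_ordering.choose_spec

theorem θs_spec (Φ : THSystem K V d) : IsIdempotentOrdering Φ.As Φ.Es Φ.θs :=
  Φ.Es_ordering.choose_spec

/-- The relative `Φ*`, obtained by exchanging the two halves of the system. -/
def star (Φ : THSystem K V d) : THSystem K V d where
  A := Φ.As
  E := Φ.Es
  As := Φ.A
  Es := Φ.E
  finrank_eq := Φ.finrank_eq
  A_multFree := Φ.As_multFree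
  As_multFree := Φ.A_multFree
  E_ordering := Φ.Es_ordering
  Es_ordering := Φ.E_ordering
  E_As_zero := Φ.Es_A_zero
  E_As_ne_zero := Φ.Es_A_ne_zero
  Es_A_zero := Φ.E_As_zero
  Es_A_ne_zero := Φ.E_As_ne_zero

theorem dualMap_ne_zero {S : Module.End K V} (hS : S ≠ 0) : S.dualMap ≠ 0 := by
  intro h
  apply hS
  ext v
  rw [LinearMap.zero_apply, ← Module.forall_dual_apply_eq_zero_iff K]
  intro f
  have := LinearMap.congr_fun (LinearMap.congr_fun h f) v
  simpa using this

/-- The relative `Φ~`, a system on the dual space: the canonical anti-isomorphism sends an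
endomorphism to its transpose, and both orderings of the idempotents are reversed. -/
def tilde (Φ : THSystem K V d) : THSystem K (Module.Dual K V) d where
  A := Φ.A.dualMap
  E := fun i => (Φ.E i.rev).dualMap
  As := Φ.As.dualMap
  Es := fun i => (Φ.Es i.rev).dualMap
  finrank_eq := by rw [Subspace.dual_finrank_eq, Φ.finrank_eq]
  A_multFree := haveI := Φ.finiteDimensional; (Φ.θ_spec.dual Φ.A_multFree).1
  As_multFree := haveI := Φ.finiteDimensional; (Φ.θs_spec.dual Φ.As_multFree).1
  E_ordering := haveI := Φ.finiteDimensional; ⟨_, (Φ.θ_spec.dual Φ.A_multFree).2⟩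
  Es_ordering := haveI := Φ.finiteDimensional; ⟨_, (Φ.θs_spec.dual Φ.As_multFree).2⟩
  E_As_zero := fun i j hij => by
    have h := Φ.E_As_zero j.rev i.rev (by simp only [Fin.val_rev]; omega)
    have h2 : (Φ.E j.rev * Φ.As * Φ.E i.rev).dualMap = 0 := by
      rw [h]; exact map_zero (Module.Dual.transpose (R := K) (M := V) (M' := V))
    exact h2
  E_As_ne_zero := fun i j hij =>
    dualMap_ne_zero (Φ.E_As_ne_zero j.rev i.rev (by simp only [Fin.val_rev]; omega))
  Es_A_zero := fun i j hij => by
    have h := Φ.Es_A_zero j.rev i.rev (by simp only [Fin.val_rev]; omega)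
    have h2 : (Φ.Es j.rev * Φ.A * Φ.Es i.rev).dualMap = 0 := by
      rw [h]; exact map_zero (Module.Dual.transpose (R := K) (M := V) (M' := V))
    exact h2
  Es_A_ne_zero := fun i j hij =>
    dualMap_ne_zero (Φ.Es_A_ne_zero j.rev i.rev (by simp only [Fin.val_rev]; omega))

/-! ### Standard bases exist -/

theorem sum_E_apply (Φ : THSystem K V d) (v : V) : ∑ i, Φ.E i v = v := by
  have := LinearMap.congr_fun (Φ.θ_spec.sum_eq_one Φ.A_multFree) v
  simpa [LinearMap.sum_apply] using this

theorem E_E_apply (Φ : THSystem K V d) (i j : Fin (d + 1)) (v : V) :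
    Φ.E i (Φ.E j v) = if i = j then Φ.E i v else 0 := by
  have := LinearMap.congr_fun (Φ.θ_spec.mul_eq Φ.A_multFree i j) v
  rw [Module.End.mul_apply] at this
  rw [this]
  split_ifs <;> rfl

theorem E_A_apply (Φ : THSystem K V d) (i : Fin (d + 1)) (v : V) :
    Φ.E i (Φ.A v) = Φ.θ i • Φ.E i v :=
  LinearMap.congr_fun (Φ.θ_spec.mul_map Φ.A_multFree i) v

theorem A_E_apply (Φ : THSystem K V d) (i : Fin (d + 1)) (v : V) :
    Φ.A (Φ.E i v) = Φ.θ i • Φ.E i v :=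
  LinearMap.congr_fun (Φ.θ_spec.map_mul Φ.A_multFree i) v

/-- The idempotents have rank one. -/
theorem exists_smul_eq (Φ : THSystem K V d) (i : Fin (d + 1)) (v w : V) (hv : Φ.E i v ≠ 0) :
    ∃ c : K, c • Φ.E i v = Φ.E i w := by
  have h := Φ.θ_spec.finrank_range Φ.A_multFree i
  obtain ⟨c, hc⟩ := (finrank_eq_one_iff_of_nonzero'
    (⟨Φ.E i v, v, rfl⟩ : LinearMap.range (Φ.E i)) (fun e => hv (congrArg Subtype.val e))).1 h
    ⟨Φ.E i w, w, rfl⟩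
  exact ⟨c, congrArg Subtype.val hc⟩

/-- Each factor `As - c` moves the top component of a vector up by exactly one. -/
theorem raise_step (Φ : THSystem K V d) (k : ℕ) (c : K) (v : V)
    (hv : ∀ j : Fin (d + 1), k < j.val → Φ.E j v = 0) :
    (∀ j : Fin (d + 1), k + 1 < j.val → Φ.E j (Φ.As v - c • v) = 0) ∧
    ∀ (i j : Fin (d + 1)), i.val = k → j.val = k + 1 → Φ.E i v ≠ 0 →
      Φ.E j (Φ.As v - c • v) ≠ 0 := by
  have key : ∀ j : Fin (d + 1), Φ.E j (Φ.As v) = ∑ i, (Φ.E j * Φ.As * Φ.E i) v := by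
    intro j
    conv_lhs => rw [← Φ.sum_E_apply v]
    simp [map_sum, Module.End.mul_apply]
  constructor
  · intro j hj
    rw [map_sub, _root_.map_smul, hv j (by omega), smul_zero, sub_zero, key]
    refine Finset.sum_eq_zero fun i _ => ?_
    by_cases hi : k < i.val
    · rw [Module.End.mul_apply, hv i hi, map_zero]
    · rw [Φ.E_As_zero j i (by omega)]; rfl
  · intro i j hi hj hne
    rw [map_sub, _root_.map_smul, hv j (by omega), smul_zero, sub_zero, key,
      Finset.sum_eq_single i]
    · intro h0
      apply Φ.E_As_ne_zero j i (by omega)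
      ext w
      obtain ⟨a, ha⟩ := Φ.exists_smul_eq i v w hne
      rw [Module.End.mul_apply, ← ha, _root_.map_smul]
      rw [Module.End.mul_apply] at h0
      rw [h0]; simp
    · intro l _ hl
      by_cases hlk : k < l.val
      · rw [Module.End.mul_apply, hv l hlk, map_zero]
      · have : l.val ≠ i.val := fun e => hl (Fin.ext e)
        rw [Φ.E_As_zero j l (by omega)]; rfl
    · simp

theorem raise_prod (Φ : THSystem K V d) (k : ℕ) (v : V)
    (hv : ∀ j : Fin (d + 1), k < j.val → Φ.E j v = 0) (c : Fin (d + 1) → K)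
    (S : Finset (Fin (d + 1))) :
    (∀ j : Fin (d + 1), k + S.card < j.val →
      Φ.E j (aeval Φ.As (∏ h ∈ S, (X - C (c h))) v) = 0) ∧
    ∀ (i j : Fin (d + 1)), i.val = k → j.val = k + S.card → Φ.E i v ≠ 0 →
      Φ.E j (aeval Φ.As (∏ h ∈ S, (X - C (c h))) v) ≠ 0 := by
  classical
  induction S using Finset.induction_on with
  | empty =>
    refine ⟨fun j hj => by simpa using hv j (by simpa using hj), fun i j hi hj hne => ?_⟩
    have : i = j := Fin.ext (by simp at hj; omega)
    subst this
    simpa using hne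
  | insert a S ha ih =>
    have hw : aeval Φ.As (∏ h ∈ insert a S, (X - C (c h))) v =
        Φ.As (aeval Φ.As (∏ h ∈ S, (X - C (c h))) v) -
          c a • aeval Φ.As (∏ h ∈ S, (X - C (c h))) v := by
      rw [Finset.prod_insert ha, map_mul, Module.End.mul_apply]
      simp [Module.algebraMap_end_apply]
    have hstep := Φ.raise_step (k + S.card) (c a) _ ih.1
    rw [hw, Finset.card_insert_of_notMem ha]
    refine ⟨fun j hj => hstep.1 j (by omega), fun i j hi hj hne => ?_⟩
    exact hstep.2 ⟨k + S.card, by omega⟩ j rfl (by omega)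
      (ih.2 i _ hi rfl hne)

theorem Es_Es_apply (Φ : THSystem K V d) (i j : Fin (d + 1)) (v : V) :
    Φ.Es i (Φ.Es j v) = if i = j then Φ.Es i v else 0 :=
  Φ.star.E_E_apply i j v

theorem aeval_As_eq (Φ : THSystem K V d) (q : K[X]) (v : V) :
    aeval Φ.As q v = ∑ h, q.eval (Φ.θs h) • Φ.Es h v := by
  have hq : ∀ h, aeval Φ.As q (Φ.Es h v) = q.eval (Φ.θs h) • Φ.Es h v := fun h =>
    Module.End.aeval_apply_of_mem_apply_eq_smul (p := q) (Φ.star.A_E_apply h v)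
  conv_lhs => rw [← Φ.star.sum_E_apply v]
  rw [map_sum]
  exact Finset.sum_congr rfl fun h _ => hq h

theorem Es_apply_ne_zero (Φ : THSystem K V d) {ξ : V} (hξ : ξ ∈ LinearMap.range (Φ.E 0))
    (h0 : ξ ≠ 0) (i : Fin (d + 1)) : Φ.Es i ξ ≠ 0 := by
  classical
  obtain ⟨w, rfl⟩ := hξ
  intro hi
  have hz : ∀ j : Fin (d + 1), 0 < j.val → Φ.E j (Φ.E 0 w) = 0 := fun j hj => by
    rw [Φ.E_E_apply, if_neg (fun e => by simp [e] at hj)]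
  refine (Φ.raise_prod 0 _ hz Φ.θs (Finset.univ.erase i)).2 0 (Fin.last d) rfl ?_ ?_ ?_
  · simp
  · rwa [Φ.E_E_apply, if_pos rfl]
  · rw [Φ.aeval_As_eq, Finset.sum_eq_zero, map_zero]
    intro h _
    by_cases hhi : h = i
    · rw [hhi, hi, smul_zero]
    · rw [eval_prod, Finset.prod_eq_zero (i := h) (by simp [hhi]) (by simp), zero_smul]

theorem Es_linearIndependent (Φ : THSystem K V d) {ξ : V} (hξ : ξ ∈ LinearMap.range (Φ.E 0))
    (h0 : ξ ≠ 0) : LinearIndependent K (fun i => Φ.Es i ξ) := by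
  rw [Fintype.linearIndependent_iff]
  intro g hg i
  have h1 := congrArg (Φ.Es i) hg
  rw [map_sum, map_zero, Finset.sum_eq_single i] at h1
  · rw [_root_.map_smul, Φ.Es_Es_apply i i, if_pos rfl] at h1
    exact (smul_eq_zero.1 h1).resolve_right (Φ.Es_apply_ne_zero hξ h0 i)
  · intro j _ hj
    rw [_root_.map_smul, Φ.Es_Es_apply i j, if_neg hj.symm, smul_zero]
  · simp

/-- The `Φ`-standard basis `Es 0 ξ, …, Es d ξ` given by a nonzero vector `ξ` of `E 0 V`. -/
def stdBasis (Φ : THSystem K V d) (ξ : V) (hξ : ξ ∈ LinearMap.range (Φ.E 0)) (h0 : ξ ≠ 0) :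
    Module.Basis (Fin (d + 1)) K V :=
  basisOfLinearIndependentOfCardEqFinrank (Φ.Es_linearIndependent hξ h0)
    (by rw [Φ.finrank_eq, Fintype.card_fin])

theorem stdBasis_apply (Φ : THSystem K V d) (ξ : V) (hξ : ξ ∈ LinearMap.range (Φ.E 0))
    (h0 : ξ ≠ 0) (i : Fin (d + 1)) : Φ.stdBasis ξ hξ h0 i = Φ.Es i ξ := by
  simp [stdBasis]

theorem exists_ξ (Φ : THSystem K V d) : ∃ ξ : V, ξ ∈ LinearMap.range (Φ.E 0) ∧ ξ ≠ 0 := by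
  obtain ⟨v, hv, hv0⟩ := (Φ.θ_spec.primitive 0).hasEigenvalue.exists_hasEigenvector
  exact ⟨v, by rwa [Φ.θ_spec.range_eq Φ.A_multFree], hv0⟩

/-- A choice of nonzero vector in `E 0 V`; nothing below depends on it. -/
def ξ (Φ : THSystem K V d) : V := Φ.exists_ξ.choose

theorem ξ_mem (Φ : THSystem K V d) : Φ.ξ ∈ LinearMap.range (Φ.E 0) := Φ.exists_ξ.choose_spec.1

theorem ξ_ne_zero (Φ : THSystem K V d) : Φ.ξ ≠ 0 := Φ.exists_ξ.choose_spec.2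

/-! ### The transition matrix `P` -/

theorem Es_mem_star (Φ : THSystem K V d) (v : V) :
    Φ.Es 0 v ∈ LinearMap.range (Φ.star.E 0) := ⟨v, rfl⟩

/-- The transition matrix `P` from the basis `E i (Es 0 ξ)` to the basis `Es i ξ`, where `ξ` is a
nonzero vector of `E 0 V`: thus `Es j ξ = ∑ i, P i j • E i (Es 0 ξ)`. -/
def P (Φ : THSystem K V d) : Matrix (Fin (d + 1)) (Fin (d + 1)) K :=
  (Φ.star.stdBasis (Φ.Es 0 Φ.ξ) (Φ.Es_mem_star Φ.ξ) (Φ.Es_apply_ne_zero Φ.ξ_mem Φ.ξ_ne_zero 0)).toMatrix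
    (Φ.stdBasis Φ.ξ Φ.ξ_mem Φ.ξ_ne_zero)

theorem exists_smul_ξ (Φ : THSystem K V d) (ζ : V) (hζ : ζ ∈ LinearMap.range (Φ.E 0)) :
    ∃ c : K, c • Φ.ξ = ζ := by
  have fix : ∀ v ∈ LinearMap.range (Φ.E 0), Φ.E 0 v = v := by
    rintro _ ⟨w, rfl⟩
    rw [Φ.E_E_apply, if_pos rfl]
  obtain ⟨c, hc⟩ := Φ.exists_smul_eq 0 Φ.ξ ζ (by rw [fix _ Φ.ξ_mem]; exact Φ.ξ_ne_zero)
  exact ⟨c, by rwa [fix _ Φ.ξ_mem, fix _ hζ] at hc⟩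

/-- `P` does not depend on the vector used in its definition. -/
theorem P_spec (Φ : THSystem K V d) (ζ : V) (hζ : ζ ∈ LinearMap.range (Φ.E 0))
    (j : Fin (d + 1)) : Φ.Es j ζ = ∑ i, Φ.P i j • Φ.E i (Φ.Es 0 ζ) := by
  obtain ⟨c, rfl⟩ := Φ.exists_smul_ξ ζ hζ
  have h := (Φ.star.stdBasis (Φ.Es 0 Φ.ξ) (Φ.Es_mem_star Φ.ξ)
    (Φ.Es_apply_ne_zero Φ.ξ_mem Φ.ξ_ne_zero 0)).sum_toMatrix_smul_self
    (Φ.stdBasis Φ.ξ Φ.ξ_mem Φ.ξ_ne_zero) j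
  simp only [stdBasis_apply] at h
  simp only [_root_.map_smul]
  rw [← h, Finset.smul_sum]
  refine Finset.sum_congr rfl fun i _ => ?_
  exact smul_comm _ _ _

/-! ### The polynomials `s` -/

/-- The matrix representing `A` with respect to a `Φ`-standard basis. -/
def H (Φ : THSystem K V d) : Matrix (Fin (d + 1)) (Fin (d + 1)) K :=
  LinearMap.toMatrix (Φ.stdBasis Φ.ξ Φ.ξ_mem Φ.ξ_ne_zero) (Φ.stdBasis Φ.ξ Φ.ξ_mem Φ.ξ_ne_zero) Φ.A

/-- `H` does not depend on the choice of the `Φ`-standard basis. -/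
theorem H_spec (Φ : THSystem K V d) (ζ : V) (hζ : ζ ∈ LinearMap.range (Φ.E 0))
    (j : Fin (d + 1)) : Φ.A (Φ.Es j ζ) = ∑ i, Φ.H i j • Φ.Es i ζ := by
  obtain ⟨c, rfl⟩ := Φ.exists_smul_ξ ζ hζ
  have h := (Φ.stdBasis Φ.ξ Φ.ξ_mem Φ.ξ_ne_zero).sum_repr
    (Φ.A (Φ.stdBasis Φ.ξ Φ.ξ_mem Φ.ξ_ne_zero j))
  simp only [stdBasis_apply] at h
  simp only [_root_.map_smul]
  rw [← h, Finset.smul_sum]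
  refine Finset.sum_congr rfl fun i _ => ?_
  rw [smul_comm, H, LinearMap.toMatrix_apply, stdBasis_apply]

end THSystem

/-- `H` is Hessenberg: zero below the subdiagonal, nonzero on the subdiagonal. -/
def IsHessenberg {K : Type*} [Field K] {d : ℕ} (H : Matrix (Fin (d + 1)) (Fin (d + 1)) K) : Prop :=
  ∀ i j : Fin (d + 1), (j.val + 1 < i.val → H i j = 0) ∧ (i.val = j.val + 1 → H i j ≠ 0)

/-- The product of the subdiagonal entries. -/
def subdiagProd {K : Type*} [Field K] {d : ℕ} (H : Matrix (Fin (d + 1)) (Fin (d + 1)) K) : K :=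
  ∏ k : Fin d, H k.succ k.castSucc

/-- The polynomials of a Hessenberg matrix `H`, by the recursion obtained on solving
`λ f_j = ∑_{i ≤ j+1} H_{ij} f_i` for `f_{j+1}` (`j < d`), and
`λ f_d = c⁻¹ f_{d+1} + ∑_{i ≤ d} H_{id} f_i` for `f_{d+1}`, with `c` the product of the subdiagonal
entries of `H`; see `hessPoly_spec`. -/
def hessPolyNat {K : Type*} [Field K] {d : ℕ} (H : Matrix (Fin (d + 1)) (Fin (d + 1)) K) : ℕ → K[X]
  | 0 => 1
  | j + 1 =>
    (if h : j < d then C (H ⟨j + 1, by omega⟩ ⟨j, by omega⟩)⁻¹ else C (subdiagProd H)) *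
      (X * hessPolyNat H j -
        ∑ i : Fin (j + 1), C (H (Fin.ofNat (d + 1) i) (Fin.ofNat (d + 1) j)) * hessPolyNat H i)
  termination_by n => n
  decreasing_by all_goals omega

/-- The polynomials `f_0, …, f_{d+1}` of a Hessenberg matrix. -/
def hessPoly {K : Type*} [Field K] {d : ℕ} (H : Matrix (Fin (d + 1)) (Fin (d + 1)) K) :
    Fin (d + 2) → K[X] := fun i => hessPolyNat H i

/-- The defining equations of the polynomials of a Hessenberg matrix. -/
theorem hessPoly_spec {K : Type*} [Field K] {d : ℕ} (H : Matrix (Fin (d + 1)) (Fin (d + 1)) K)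
    (hH : IsHessenberg H) :
    hessPoly H 0 = 1 ∧
    (∀ j : Fin d, X * hessPoly H j.castSucc.castSucc =
      ∑ i : Fin (d + 1) with i.val ≤ j.val + 1, C (H i j.castSucc) * hessPoly H i.castSucc) ∧
    X * hessPoly H (Fin.last d).castSucc =
      C (subdiagProd H)⁻¹ * hessPoly H (Fin.last (d + 1)) +
        ∑ i : Fin (d + 1), C (H i (Fin.last d)) * hessPoly H i.castSucc := by
  have hsub : ∀ j : Fin (d + 1), ∑ i : Fin (j.val + 1),
      C (H (Fin.ofNat (d + 1) i) (Fin.ofNat (d + 1) j.val)) * hessPolyNat H i =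
      ∑ i : Fin (d + 1) with i.val ≤ j.val, C (H i j) * hessPolyNat H i := by
    intro j
    refine Finset.sum_bij (fun i _ => Fin.castLE (by omega) i) ?_ ?_ ?_ ?_
    · intro i _
      simp only [Finset.mem_filter, Finset.mem_univ, true_and, Fin.val_castLE]
      omega
    · intro a _ b _ hab
      exact Fin.castLE_injective _ hab
    · intro b hb
      simp only [Finset.mem_filter, Finset.mem_univ, true_and] at hb
      exact ⟨⟨b.val, by omega⟩, Finset.mem_univ _, rfl⟩
    · intro i _
      have e1 : Fin.ofNat (d + 1) i.val = Fin.castLE (by omega) i := by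
        ext
        simp only [Fin.val_ofNat, Fin.val_castLE]
        exact Nat.mod_eq_of_lt (by omega)
      have e2 : Fin.ofNat (d + 1) j.val = j := by
        ext
        simp only [Fin.val_ofNat]
        exact Nat.mod_eq_of_lt j.isLt
      rw [e1, e2]
      rfl
  have hc : subdiagProd H ≠ 0 :=
    Finset.prod_ne_zero_iff.2 fun k _ => (hH k.succ k.castSucc).2 (by simp)
  refine ⟨by simp [hessPoly, hessPolyNat], fun j => ?_, ?_⟩
  · have hne : H j.succ j.castSucc ≠ 0 := (hH _ _).2 (by simp)
    have hrec : hessPolyNat H (j.val + 1) = C (H j.succ j.castSucc)⁻¹ *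
        (X * hessPolyNat H j.val -
          ∑ i : Fin (d + 1) with i.val ≤ j.val, C (H i j.castSucc) * hessPolyNat H i) := by
      rw [hessPolyNat, dif_pos j.isLt]
      have := hsub j.castSucc
      simp only [Fin.val_castSucc] at this
      rw [this]
      rfl
    have hfil : (Finset.univ.filter fun i : Fin (d + 1) => i.val ≤ j.val + 1) =
        insert j.succ (Finset.univ.filter fun i : Fin (d + 1) => i.val ≤ j.val) := by
      ext i
      simp only [Finset.mem_filter, Finset.mem_univ, true_and, Finset.mem_insert, Fin.ext_iff,
        Fin.val_succ]
      omega
    rw [hfil, Finset.sum_insert (by simp)]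
    simp only [hessPoly, Fin.val_castSucc, Fin.val_succ]
    rw [hrec, ← mul_assoc, ← C_mul, mul_inv_cancel₀ hne]
    simp
  · have hrec : hessPolyNat H (d + 1) = C (subdiagProd H) *
        (X * hessPolyNat H d - ∑ i : Fin (d + 1), C (H i (Fin.last d)) * hessPolyNat H i) := by
      rw [hessPolyNat, dif_neg (lt_irrefl d)]
      have := hsub (Fin.last d)
      simp only [Fin.val_last] at this
      rw [this, Finset.filter_true_of_mem (fun i _ => by omega)]
    simp only [hessPoly, Fin.val_castSucc, Fin.val_last]
    rw [hrec, ← mul_assoc, ← C_mul, inv_mul_cancel₀ hc]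
    simp

namespace THSystem

variable {K V : Type*} [Field K] [AddCommGroup V] [Module K V] {d : ℕ}

theorem H_isHessenberg (Φ : THSystem K V d) : IsHessenberg Φ.H := by
  have key : ∀ (i j : Fin (d + 1)), (Φ.Es i * Φ.A * Φ.Es j) Φ.ξ = Φ.H i j • Φ.Es i Φ.ξ := by
    intro i j
    rw [Module.End.mul_apply, Module.End.mul_apply, Φ.H_spec _ Φ.ξ_mem, map_sum,
      Finset.sum_eq_single i]
    · rw [_root_.map_smul, Φ.Es_Es_apply i i, if_pos rfl]
    · intro l _ hl
      rw [_root_.map_smul, Φ.Es_Es_apply i l, if_neg hl.symm, smul_zero]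
    · simp
  have hne := Φ.Es_apply_ne_zero Φ.ξ_mem Φ.ξ_ne_zero
  refine fun i j => ⟨fun hij => ?_, fun hij h0 => Φ.Es_A_ne_zero i j hij ?_⟩
  · have h := key i j
    rw [Φ.Es_A_zero i j hij] at h
    exact (smul_eq_zero.1 h.symm).resolve_right (hne i)
  · have h := key i j
    rw [h0, zero_smul] at h
    ext w
    obtain ⟨a, ha⟩ := Φ.star.exists_smul_eq j Φ.ξ w (hne j)
    change a • Φ.Es j Φ.ξ = Φ.Es j w at ha
    rw [Module.End.mul_apply, ← ha, _root_.map_smul]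
    rw [Module.End.mul_apply] at h
    rw [h]; simp

/-- The polynomials `s_0, …, s_{d+1}` of the system. -/
def s (Φ : THSystem K V d) : Fin (d + 2) → K[X] := hessPoly Φ.H

end THSystem

/-! ### The scalars `ℓ` and the polynomials `t` -/

/-- `τ_i = ∏_{h < i} (λ - θ_h)`, for `0 ≤ i ≤ d + 1`. -/
def tauPoly {K : Type*} [Field K] {d : ℕ} (θ : Fin (d + 1) → K) (i : ℕ) : K[X] :=
  ∏ h : Fin (d + 1) with h.val < i, (X - C (θ h))

/-- `η_i = ∏_{h < i} (λ - θ_{d-h})`, for `0 ≤ i ≤ d + 1`. -/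
def etaPoly {K : Type*} [Field K] {d : ℕ} (θ : Fin (d + 1) → K) (i : ℕ) : K[X] :=
  ∏ h : Fin (d + 1) with h.val < i, (X - C (θ h.rev))

namespace THSystem

variable {K V : Type*} [Field K] [AddCommGroup V] [Module K V] {d : ℕ}

/-- `ℓ_i = η*_d(θ*_0) / (τ*_i(θ*_i) η*_{d-i}(θ*_i))`. -/
def ell (Φ : THSystem K V d) (i : Fin (d + 1)) : K :=
  (etaPoly Φ.θs d).eval (Φ.θs 0) /
    ((tauPoly Φ.θs i).eval (Φ.θs i) * (etaPoly Φ.θs (d - i.val)).eval (Φ.θs i))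

/-- The diagonal matrix with entries `ℓ_0, …, ℓ_d`. -/
def L (Φ : THSystem K V d) : Matrix (Fin (d + 1)) (Fin (d + 1)) K := Matrix.diagonal Φ.ell

/-- `t_i = s_i / ℓ_i` for `0 ≤ i ≤ d`, and `t_{d+1} = s_{d+1}`. -/
def t (Φ : THSystem K V d) : Fin (d + 2) → K[X] :=
  Fin.snoc (α := fun _ => K[X]) (fun i : Fin (d + 1) => C (Φ.ell i)⁻¹ * Φ.s i.castSucc)
    (Φ.s (Fin.last (d + 1)))

/-! ### The split sequence and the matrix `𝒫` -/

/-- The split decomposition `U_i = (Es 0 V + ⋯ + Es i V) ∩ (E 0 V + ⋯ + E (d-i) V)`. -/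
def U (Φ : THSystem K V d) (i : Fin (d + 1)) : Submodule K V :=
  (⨆ h : {h : Fin (d + 1) // h ≤ i}, LinearMap.range (Φ.Es h)) ⊓
    (⨆ h : {h : Fin (d + 1) // h ≤ i.rev}, LinearMap.range (Φ.E h))

theorem mem_iSup_range_E (Φ : THSystem K V d) (i : Fin (d + 1)) (v : V) :
    v ∈ (⨆ h : {h : Fin (d + 1) // h ≤ i}, LinearMap.range (Φ.E h)) ↔
      ∀ j, i < j → Φ.E j v = 0 := by
  constructor
  · intro hv j hj
    induction hv using Submodule.iSup_induction' with
    | mem h x hx =>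
      obtain ⟨w, rfl⟩ := hx
      rw [Φ.E_E_apply, if_neg]
      rintro rfl
      exact absurd h.2 (not_le.2 hj)
    | zero => simp
    | add x y _ _ hx hy => simp [hx, hy]
  · intro hv
    rw [← Φ.sum_E_apply v]
    refine Submodule.sum_mem _ fun j _ => ?_
    by_cases hj : j ≤ i
    · exact Submodule.mem_iSup_of_mem (⟨j, hj⟩ : {h : Fin (d + 1) // h ≤ i}) ⟨v, rfl⟩
    · rw [hv j (not_le.1 hj)]
      exact Submodule.zero_mem _

theorem mem_U (Φ : THSystem K V d) (i : Fin (d + 1)) (v : V) :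
    v ∈ Φ.U i ↔ (∀ j, i < j → Φ.Es j v = 0) ∧ ∀ j, i.rev < j → Φ.E j v = 0 := by
  rw [U, Submodule.mem_inf, Φ.mem_iSup_range_E]
  exact and_congr_left' (Φ.star.mem_iSup_range_E i v)

/-- The sum `Es 0 V + ⋯ + Es (i-1) V` meets `E 0 V + ⋯ + E (d-i) V` only in zero. -/
theorem eq_zero_of_small (Φ : THSystem K V d) (i : Fin (d + 1)) (v : V)
    (h1 : ∀ j, i ≤ j → Φ.Es j v = 0) (h2 : ∀ j, i.rev < j → Φ.E j v = 0) : v = 0 := by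
  classical
  by_contra hv
  have hne : (Finset.univ.filter fun j => Φ.E j v ≠ 0).Nonempty := by
    by_contra hemp
    rw [Finset.not_nonempty_iff_eq_empty, Finset.filter_eq_empty_iff] at hemp
    apply hv
    rw [← Φ.sum_E_apply v]
    exact Finset.sum_eq_zero fun j hj => not_not.1 (hemp hj)
  obtain ⟨k, hk, hmax⟩ := Finset.exists_max_image _ (fun j : Fin (d + 1) => j) hne
  simp only [Finset.mem_filter, Finset.mem_univ, true_and] at hk hmax
  have hki : k ≤ i.rev := not_lt.1 fun hlt => hk (h2 k hlt)
  rw [Fin.le_def, Fin.val_rev] at hki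
  have hz : ∀ j : Fin (d + 1), k.val < j.val → Φ.E j v = 0 := fun j hj => by
    by_contra hj0
    exact absurd (hmax j hj0) (not_le.2 hj)
  have hcard : (Finset.univ.filter fun h : Fin (d + 1) => h < i).card = i.val := by
    rw [Finset.filter_gt_eq_Iio, Fin.card_Iio]
  refine (Φ.raise_prod k.val v hz Φ.θs (Finset.univ.filter fun h => h < i)).2 k
    ⟨k.val + i.val, by omega⟩ rfl (by rw [hcard]) hk ?_
  rw [Φ.aeval_As_eq, Finset.sum_eq_zero, map_zero]
  intro h _
  by_cases hhi : h < i
  · rw [eval_prod, Finset.prod_eq_zero (i := h) (by simp [hhi]) (by simp), zero_smul]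
  · rw [h1 h (not_lt.1 hhi), smul_zero]

theorem exists_mem_U_ne_zero (Φ : THSystem K V d) (i : Fin (d + 1)) : ∃ v ∈ Φ.U i, v ≠ 0 := by
  classical
  obtain ⟨w, hw⟩ := Φ.ξ_mem
  have hcard : (Finset.univ.filter fun h : Fin (d + 1) => i < h).card = i.rev.val := by
    rw [Finset.filter_lt_eq_Ioi, Fin.card_Ioi, Fin.val_rev]
    omega
  have hz : ∀ j : Fin (d + 1), (0 : Fin (d + 1)).val < j.val → Φ.E j Φ.ξ = 0 := fun j hj => by
    rw [← hw, Φ.E_E_apply, if_neg (fun e => by simp [e] at hj)]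
  have hp := Φ.raise_prod _ Φ.ξ hz Φ.θs (Finset.univ.filter fun h => i < h)
  rw [hcard] at hp
  refine ⟨aeval Φ.As (∏ h with i < h, (X - C (Φ.θs h))) Φ.ξ, (Φ.mem_U _ _).2 ⟨?_, ?_⟩, ?_⟩
  · intro j hj
    rw [Φ.aeval_As_eq, map_sum]
    refine Finset.sum_eq_zero fun h _ => ?_
    rw [_root_.map_smul, Φ.Es_Es_apply j h]
    by_cases hjh : j = h
    · subst hjh
      rw [eval_prod, Finset.prod_eq_zero (i := j) (by simp [hj]) (by simp), zero_smul]
    · rw [if_neg hjh, smul_zero]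
  · intro j hj
    exact hp.1 j (by simpa [Fin.lt_def] using hj)
  · intro h0
    refine hp.2 0 i.rev rfl (by simp) ?_ (by rw [h0, map_zero])
    rw [← hw, Φ.E_E_apply, if_pos rfl, hw]
    exact Φ.ξ_ne_zero

/-- Each `U_i` has dimension at most one. -/
theorem exists_smul_of_mem_U (Φ : THSystem K V d) (i : Fin (d + 1)) (u v : V) (hu : u ∈ Φ.U i)
    (hu0 : u ≠ 0) (hv : v ∈ Φ.U i) : ∃ c : K, v = c • u := by
  have inj : ∀ w ∈ Φ.U i, Φ.Es i w = 0 → w = 0 := by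
    intro w hw hi
    rw [Φ.mem_U] at hw
    refine Φ.eq_zero_of_small i w (fun j hj => ?_) hw.2
    rcases hj.eq_or_lt with rfl | hlt
    · exact hi
    · exact hw.1 j hlt
  obtain ⟨c, hc⟩ := Φ.star.exists_smul_eq i u v (fun h => hu0 (inj u hu h))
  change c • Φ.Es i u = Φ.Es i v at hc
  refine ⟨c, sub_eq_zero.1 (inj _ (sub_mem hv (Submodule.smul_mem _ c hu)) ?_)⟩
  rw [map_sub, _root_.map_smul, hc, sub_self]

/-- `(As - θ*_i) U_i ⊆ U_{i-1}`. -/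
theorem lower_mem_U (Φ : THSystem K V d) (k : Fin d) (u : V) (hu : u ∈ Φ.U k.succ) :
    (Φ.As - Φ.θs k.succ • 1) u ∈ Φ.U k.castSucc := by
  rw [Φ.mem_U] at hu ⊢
  have e : (Φ.As - Φ.θs k.succ • (1 : Module.End K V)) u = Φ.As u - Φ.θs k.succ • u := rfl
  rw [e]
  refine ⟨fun j hj => ?_, fun j hj => ?_⟩
  · have h1 : Φ.Es j (Φ.As u) = Φ.θs j • Φ.Es j u := Φ.star.E_A_apply j u
    rw [map_sub, _root_.map_smul, h1]
    rcases (show k.succ ≤ j from hj).eq_or_lt with h | h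
    · rw [h, sub_self]
    · rw [hu.1 j h, smul_zero, smul_zero, sub_self]
  · refine (Φ.raise_step k.succ.rev.val _ u (fun l hl => hu.2 l hl)).1 j ?_
    have h1 := k.isLt
    rw [Fin.lt_def] at hj
    simp only [Fin.val_rev, Fin.val_succ, Fin.val_castSucc] at hj ⊢
    omega

/-- `(A - θ_{d-i+1}) U_{i-1} ⊆ U_i`. -/
theorem raise_mem_U (Φ : THSystem K V d) (k : Fin d) (u : V) (hu : u ∈ Φ.U k.castSucc) :
    (Φ.A - Φ.θ k.castSucc.rev • 1) u ∈ Φ.U k.succ := by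
  rw [Φ.mem_U] at hu ⊢
  have e : (Φ.A - Φ.θ k.castSucc.rev • (1 : Module.End K V)) u =
    Φ.A u - Φ.θ k.castSucc.rev • u := rfl
  rw [e]
  refine ⟨fun j hj => ?_, fun j hj => ?_⟩
  · exact (Φ.star.raise_step k.castSucc.val _ u (fun l hl => hu.1 l hl)).1 j hj
  · rw [map_sub, _root_.map_smul, Φ.E_A_apply]
    have h1 : k.castSucc.rev ≤ j := by
      have h2 := k.isLt
      rw [Fin.lt_def] at hj
      rw [Fin.le_def]
      simp only [Fin.val_rev, Fin.val_succ, Fin.val_castSucc] at hj ⊢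
      omega
    rcases h1.eq_or_lt with h | h
    · rw [h, sub_self]
    · rw [hu.2 j h, smul_zero, smul_zero, sub_self]

theorem existsUnique_split (Φ : THSystem K V d) (k : Fin d) :
    ∃! c : K, ∀ u ∈ Φ.U k.succ,
      ((Φ.A - Φ.θ k.castSucc.rev • 1) * (Φ.As - Φ.θs k.succ • 1)) u = c • u := by
  obtain ⟨v, hv, hv0⟩ := Φ.exists_mem_U_ne_zero k.succ
  obtain ⟨c, hc⟩ := Φ.exists_smul_of_mem_U k.succ v _ hv hv0
    (Φ.raise_mem_U k _ (Φ.lower_mem_U k v hv))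
  refine ⟨c, fun u hu => ?_, fun c' hc' => ?_⟩
  · obtain ⟨a, rfl⟩ := Φ.exists_smul_of_mem_U k.succ v u hv hv0 hu
    rw [_root_.map_smul, Module.End.mul_apply, hc, smul_comm]
  · have h := hc' v hv
    rw [Module.End.mul_apply, hc] at h
    exact (smul_left_injective K hv0 h).symm

/-- The split sequence: `splitSeq k` is `φ_{k+1}`, the eigenvalue of
`(A - θ_{d-i+1}) (As - θ*_i)` on `U_i` for `i = k + 1`. -/
def splitSeq (Φ : THSystem K V d) (k : Fin d) : K := (Φ.existsUnique_split k).choose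

/-- The matrix with `(i, j)` entry `p(θ_i, θ*_j)`, where
`p(λ, μ) = ∑_{h=0}^d η_h(λ) τ*_h(μ) / (φ_1 ⋯ φ_h)`. -/
def scriptP (Φ : THSystem K V d) : Matrix (Fin (d + 1)) (Fin (d + 1)) K :=
  Matrix.of fun i j => ∑ h : Fin (d + 1),
    (etaPoly Φ.θ h).eval (Φ.θ i) * (tauPoly Φ.θs h).eval (Φ.θs j) /
      ∏ k : Fin d with k.val < h.val, Φ.splitSeq k

end THSystem

/-! ## Vandermonde matrices and systems -/

/-- A sequence `f_0, …, f_n` is graded: `f_0 = 1` and `f_i` has degree `i`. -/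
def IsGraded {K : Type*} [Field K] {n : ℕ} (f : Fin (n + 1) → K[X]) : Prop :=
  f 0 = 1 ∧ ∀ i, (f i).degree = (i.val : WithBot ℕ)

/-- The matrix `X` is west Vandermonde. -/
def IsWestVandermonde {K : Type*} [Field K] {d : ℕ}
    (X : Matrix (Fin (d + 1)) (Fin (d + 1)) K) : Prop :=
  (∃ (θ : Fin (d + 1) → K) (f : Fin (d + 1) → K[X]), Function.Injective θ ∧ IsGraded f ∧
    ∀ i j, X i j = X i 0 * (f j).eval (θ i)) ∧ ∀ i, X i 0 ≠ 0

/-- The sequence `θ` is compatible with the matrix `X`. -/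
def IsCompatible {K : Type*} [Field K] {d : ℕ}
    (X : Matrix (Fin (d + 1)) (Fin (d + 1)) K) (θ : Fin (d + 1) → K) : Prop :=
  Function.Injective θ ∧ ∃ f : Fin (d + 1) → K[X], IsGraded f ∧
    ∀ i j, X i j = X i 0 * (f j).eval (θ i)

/-- `(X, θ)` is a west Vandermonde system. -/
def IsWestVandermondeSystem {K : Type*} [Field K] {d : ℕ}
    (X : Matrix (Fin (d + 1)) (Fin (d + 1)) K) (θ : Fin (d + 1) → K) : Prop :=
  IsWestVandermonde X ∧ IsCompatible X θ

/-- `(X, θ)` is a west Vandermonde system and `f_0, …, f_{d+1}` are its polynomials: `f_0, …, f_d`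
is the graded sequence with `X i j = X i 0 * f_j(θ_i)`, and `f_{d+1} = ∏ (λ - θ_i)`. -/
structure IsWestVandermondeSystemWith {K : Type*} [Field K] {d : ℕ}
    (M : Matrix (Fin (d + 1)) (Fin (d + 1)) K) (θ : Fin (d + 1) → K)
    (f : Fin (d + 2) → K[X]) : Prop where
  system : IsWestVandermondeSystem M θ
  graded : IsGraded (fun i : Fin (d + 1) => f i.castSucc)
  entry : ∀ i j : Fin (d + 1), M i j = M i 0 * (f j.castSucc).eval (θ i)
  last : f (Fin.last (d + 1)) = ∏ i, (X - C (θ i))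

/-- The polynomials of a west Vandermonde system are unique. -/
theorem IsWestVandermondeSystemWith.unique {K : Type*} [Field K] {d : ℕ}
    {M : Matrix (Fin (d + 1)) (Fin (d + 1)) K} {θ : Fin (d + 1) → K} {f g : Fin (d + 2) → K[X]}
    (hf : IsWestVandermondeSystemWith M θ f) (hg : IsWestVandermondeSystemWith M θ g) : f = g := by
  funext i
  induction i using Fin.lastCases with
  | last => rw [hf.last, hg.last]
  | cast i =>
    refine Polynomial.eq_of_degrees_lt_of_eval_index_eq Finset.univ
      (v := θ) hf.system.2.1.injOn ?_ ?_ fun j _ => ?_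
    · rw [hf.graded.2 i]; simp only [Finset.card_univ, Fintype.card_fin]; exact_mod_cast i.isLt
    · rw [hg.graded.2 i]; simp only [Finset.card_univ, Fintype.card_fin]; exact_mod_cast i.isLt
    · exact mul_left_cancel₀ (hf.system.1.2 j) ((hf.entry j i).symm.trans (hg.entry j i))

/-- The matrix `X` rotated clockwise by 90 degrees. -/
def rotateCW {K : Type*} {d : ℕ} (X : Matrix (Fin (d + 1)) (Fin (d + 1)) K) :
    Matrix (Fin (d + 1)) (Fin (d + 1)) K :=
  Matrix.of fun i j => X j.rev i

/-- The matrix `X` is south Vandermonde. -/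
def IsSouthVandermonde {K : Type*} [Field K] {d : ℕ}
    (X : Matrix (Fin (d + 1)) (Fin (d + 1)) K) : Prop :=
  IsWestVandermonde (rotateCW X)

/-- `(X, θ)` is a south Vandermonde system. -/
def IsSouthVandermondeSystem {K : Type*} [Field K] {d : ℕ}
    (X : Matrix (Fin (d + 1)) (Fin (d + 1)) K) (θ : Fin (d + 1) → K) : Prop :=
  IsWestVandermondeSystem (rotateCW X) θ

/-- `(X, θ)` is a south Vandermonde system with polynomials `f_0, …, f_{d+1}`. -/
def IsSouthVandermondeSystemWith {K : Type*} [Field K] {d : ℕ}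
    (X : Matrix (Fin (d + 1)) (Fin (d + 1)) K) (θ : Fin (d + 1) → K)
    (f : Fin (d + 2) → K[X]) : Prop :=
  IsWestVandermondeSystemWith (rotateCW X) θ f

/-- The matrix `X` is west-south (or double) Vandermonde. -/
def IsDoubleVandermonde {K : Type*} [Field K] {d : ℕ}
    (X : Matrix (Fin (d + 1)) (Fin (d + 1)) K) : Prop :=
  IsWestVandermonde X ∧ IsSouthVandermonde X

end

/-!
Write `ξ` for a nonzero vector of `E_0 V` and `η = Es_0 ξ`. By the Hessenberg recursion,
`s_j(A) η = Es_j ξ` (`aeval_s`); comparing components in `E_i V` gives `P_{ij} = s_j(θ_i)`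
(`P_eq_eval_s`), which is the west structure of `P`.

The last row of `P` is explicit. As `As` raises the top component by one step, the component of
`q(As) ξ` in `E_d V` sees only the coefficient of degree `d` of `q` (`E_last_aeval_As`); for
`q = ∏_{h ≠ j} (λ - θ*_h)` this says that `∏_{h ≠ j} (θ*_j - θ*_h) • E_d Es_j ξ` does not depend
on `j`, hence `P_{dj} = ℓ_j` (`P_last`).

In the split basis `η_h(A) η` the map `As` is upper bidiagonal, with the `θ*_h` on the diagonal and
the `φ_h` above it, and this makes `p(A, θ*_j) η` an eigenvector of `As` for `θ*_j`
(`As_splitSum`). It is therefore a multiple of `Es_j ξ`, and the last row of `P` fixes the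
factor: `P_{ij} = ℓ_j 𝒫_{ij}` (`P_eq_ell_mul_scriptP`). The west structure of `𝒫` follows.

For the south structure, take a functional `f ≠ 0` supported on `Es_d V`, that is, a vector `ξ` for
the system `Φ~*`. Computing `f (E_i Es_j ξ)` in two ways relates `P` to the matrix `P` of `Φ~*`,
and after division by the scalars `ℓ` the relation becomes
`𝒫_{ij} = 𝒫~*_{d-j,d-i}` (`scriptP_eq_tilde_star`). Thus the south structure of `𝒫` is the west
structure of `𝒫~*`. The relation is symmetric in `Φ` and `Φ~*`, so applying it to `Φ` and to `Φ*`
covers all four relatives without passing to the double dual.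
-/

/-! ### Products of differences of distinct scalars -/

/-- `∏_{h ≠ j} (θ_j - θ_h)`, the denominator of the `j`-th Lagrange interpolation polynomial. -/
def diffProd {K : Type*} [Field K] {d : ℕ} (θ : Fin (d + 1) → K) (j : Fin (d + 1)) : K :=
  ∏ h ∈ Finset.univ.erase j, (θ j - θ h)

section DiffProd

variable {K : Type*} [Field K] {d : ℕ}

theorem diffProd_ne_zero {θ : Fin (d + 1) → K} (hθ : Function.Injective θ) (j : Fin (d + 1)) :
    diffProd θ j ≠ 0 :=
  Finset.prod_ne_zero_iff.2 fun _ hh =>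
    sub_ne_zero.2 fun e => Finset.ne_of_mem_erase hh (hθ e).symm

theorem diffProd_rev (θ : Fin (d + 1) → K) (j : Fin (d + 1)) :
    diffProd (fun i => θ i.rev) j = diffProd θ j.rev := by
  refine Finset.prod_equiv Fin.revPerm (fun h => ?_) fun h _ => rfl
  simp

theorem tauPoly_eval_mul_etaPoly_eval (θ : Fin (d + 1) → K) (j : Fin (d + 1)) :
    (tauPoly θ j).eval (θ j) * (etaPoly θ (d - j.val)).eval (θ j) = diffProd θ j := by
  have hη : (etaPoly θ (d - j.val)).eval (θ j) =
      ∏ h ∈ Finset.univ.filter (fun h : Fin (d + 1) => j.val < h.val), (θ j - θ h) := by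
    rw [etaPoly, eval_prod]
    refine Finset.prod_equiv Fin.revPerm (fun h => ?_) fun h _ => by simp
    simp only [Finset.mem_filter, Finset.mem_univ, true_and, Fin.revPerm_apply, Fin.val_rev]
    omega
  simp only [hη, tauPoly, eval_prod, eval_sub, eval_X, eval_C, diffProd]
  rw [← Finset.prod_union]
  · refine Finset.prod_congr ?_ fun h _ => rfl
    ext h
    simp only [Finset.mem_union, Finset.mem_filter, Finset.mem_univ, true_and, Finset.mem_erase,
      and_true, Ne, Fin.ext_iff]
    omega
  · rw [Finset.disjoint_filter]
    intro h _ h1 h2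
    omega

theorem etaPoly_eval_last_eq_zero (θ : Fin (d + 1) → K) {h : ℕ} (hh : 0 < h) :
    (etaPoly θ h).eval (θ (Fin.last d)) = 0 := by
  rw [etaPoly, eval_prod]
  exact Finset.prod_eq_zero (i := 0) (by simpa using hh) (by simp)

theorem tauPoly_succ (θ : Fin (d + 1) → K) (h : Fin (d + 1)) :
    tauPoly θ (h.val + 1) = (X - C (θ h)) * tauPoly θ h.val := by
  have e : (Finset.univ.filter fun i : Fin (d + 1) => i.val < h.val + 1) =
      insert h (Finset.univ.filter fun i : Fin (d + 1) => i.val < h.val) := by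
    ext i
    simp only [Finset.mem_filter, Finset.mem_univ, true_and, Finset.mem_insert, Fin.ext_iff]
    omega
  rw [tauPoly, e, Finset.prod_insert (by simp), tauPoly]

theorem etaPoly_succ (θ : Fin (d + 1) → K) (h : Fin (d + 1)) :
    etaPoly θ (h.val + 1) = (X - C (θ h.rev)) * etaPoly θ h.val :=
  tauPoly_succ (fun i => θ i.rev) h

theorem tauPoly_eval_eq_zero (θ : Fin (d + 1) → K) (j : Fin (d + 1)) :
    (tauPoly θ (d + 1)).eval (θ j) = 0 := by
  rw [tauPoly, eval_prod]
  exact Finset.prod_eq_zero (i := j) (by simp [Fin.is_le]) (by simp)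

end DiffProd

/-! ### Degrees of the polynomials of a Hessenberg matrix -/

section Hessenberg

variable {K : Type*} [Field K] {d : ℕ} {H : Matrix (Fin (d + 1)) (Fin (d + 1)) K}

/-- The bracket in the recursion for `hessPolyNat` has the degree and the leading coefficient of
its term `X * hessPolyNat H j`. -/
theorem hessPolyNat_step {j : ℕ} (ih : ∀ i ≤ j, (hessPolyNat H i).degree = i) :
    (X * hessPolyNat H j - ∑ i : Fin (j + 1),
        C (H (Fin.ofNat (d + 1) i) (Fin.ofNat (d + 1) j)) * hessPolyNat H i).degree =
      ((j + 1 : ℕ) : WithBot ℕ) ∧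
    (X * hessPolyNat H j - ∑ i : Fin (j + 1),
        C (H (Fin.ofNat (d + 1) i) (Fin.ofNat (d + 1) j)) * hessPolyNat H i).leadingCoeff =
      (hessPolyNat H j).leadingCoeff := by
  have h1 : (X * hessPolyNat H j).degree = ((j + 1 : ℕ) : WithBot ℕ) := by
    rw [degree_mul, degree_X, ih j le_rfl]
    norm_cast
    rw [add_comm]
  have h2 : (∑ i : Fin (j + 1),
      C (H (Fin.ofNat (d + 1) i) (Fin.ofNat (d + 1) j)) * hessPolyNat H i).degree <
      (X * hessPolyNat H j).degree := by
    rw [h1]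
    refine lt_of_le_of_lt (b := (j : WithBot ℕ)) ?_ (by exact_mod_cast Nat.lt_succ_self j)
    refine (degree_sum_le _ _).trans (Finset.sup_le fun i _ => ?_)
    rw [← smul_eq_C_mul]
    refine (degree_smul_le _ _).trans ?_
    rw [ih i (by omega)]
    exact_mod_cast Nat.lt_succ_iff.1 i.isLt
  refine ⟨by rw [degree_sub_eq_left_of_degree_lt h2, h1], ?_⟩
  rw [leadingCoeff_sub_of_degree_lt h2, leadingCoeff_mul, leadingCoeff_X, one_mul]

theorem hessPolyNat_degree_leadingCoeff (hH : IsHessenberg H) (j : ℕ) (hj : j ≤ d) :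
    (hessPolyNat H j).degree = j ∧ (hessPolyNat H j).leadingCoeff =
      (∏ k : Fin d with k.val < j, H k.succ k.castSucc)⁻¹ := by
  induction j using Nat.strong_induction_on with
  | _ j ih =>
    cases j with
    | zero => simp [hessPolyNat]
    | succ j =>
      obtain ⟨h1, h2⟩ := hessPolyNat_step (H := H) (j := j) fun i hi =>
        (ih i (by omega) (by omega)).1
      have hjd : j < d := by omega
      have hne : H ⟨j + 1, by omega⟩ ⟨j, by omega⟩ ≠ 0 := (hH _ _).2 rfl
      have e : (Finset.univ.filter fun k : Fin d => k.val < j + 1) =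
          insert ⟨j, hjd⟩ (Finset.univ.filter fun k : Fin d => k.val < j) := by
        ext k
        simp only [Finset.mem_filter, Finset.mem_univ, true_and, Finset.mem_insert, Fin.ext_iff]
        omega
      rw [hessPolyNat, dif_pos hjd, degree_C_mul (inv_ne_zero hne), h1, leadingCoeff_mul, h2,
        leadingCoeff_C, (ih j (by omega) (by omega)).2, e, Finset.prod_insert (by simp), mul_inv]
      exact ⟨rfl, rfl⟩

theorem hessPoly_graded (hH : IsHessenberg H) :
    IsGraded fun i : Fin (d + 1) => hessPoly H i.castSucc :=
  ⟨(hessPoly_spec H hH).1, fun i => (hessPolyNat_degree_leadingCoeff hH i (by omega)).1⟩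

/-- The factor `c_H` in the recursion makes the last polynomial monic. -/
theorem hessPoly_last (hH : IsHessenberg H) :
    (hessPoly H (Fin.last (d + 1))).degree = ((d + 1 : ℕ) : WithBot ℕ) ∧
      (hessPoly H (Fin.last (d + 1))).Monic := by
  obtain ⟨h1, h2⟩ := hessPolyNat_step (H := H) (j := d) fun i hi =>
    (hessPolyNat_degree_leadingCoeff hH i hi).1
  have hc : subdiagProd H ≠ 0 :=
    Finset.prod_ne_zero_iff.2 fun k _ => (hH k.succ k.castSucc).2 (by simp)
  have e : hessPoly H (Fin.last (d + 1)) = hessPolyNat H (d + 1) := rfl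
  rw [e, hessPolyNat, dif_neg (lt_irrefl d), degree_C_mul hc, h1, Monic, leadingCoeff_mul, h2,
    leadingCoeff_C, (hessPolyNat_degree_leadingCoeff hH d le_rfl).2,
    Finset.filter_true_of_mem fun k _ => k.isLt]
  exact ⟨rfl, mul_inv_cancel₀ hc⟩

end Hessenberg

/-! ### Vandermonde systems from a factorization -/

theorem IsWestVandermondeSystemWith.of_eq_mul {K : Type*} [Field K] {d : ℕ}
    {M : Matrix (Fin (d + 1)) (Fin (d + 1)) K} {θ : Fin (d + 1) → K} {f : Fin (d + 2) → K[X]}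
    (hθ : Function.Injective θ) (hf : IsGraded fun i : Fin (d + 1) => f i.castSucc)
    (hlast : f (Fin.last (d + 1)) = ∏ i, (X - C (θ i))) {c : Fin (d + 1) → K} (hc : ∀ i, c i ≠ 0)
    (hM : ∀ i j : Fin (d + 1), M i j = c i * (f j.castSucc).eval (θ i)) :
    IsWestVandermondeSystemWith M θ f := by
  have h0 : ∀ i, M i 0 = c i := fun i => by
    have : f (Fin.castSucc 0) = 1 := hf.1
    rw [hM, this, eval_one, mul_one]
  have hM' : ∀ i j : Fin (d + 1), M i j = M i 0 * (f j.castSucc).eval (θ i) := fun i j => by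
    rw [h0, hM]
  exact ⟨⟨⟨⟨θ, _, hθ, hf, hM'⟩, fun i => by rw [h0]; exact hc i⟩, hθ, _, hf, hM'⟩, hf, hM', hlast⟩

/-! ### Eigenvalues of the relatives -/

theorem IsIdempotentOrdering.eigenvalues_unique {K V : Type*} [Field K] [AddCommGroup V]
    [Module K V] {d : ℕ} {A : Module.End K V} {E : Fin (d + 1) → Module.End K V}
    {θ θ' : Fin (d + 1) → K} (h : IsIdempotentOrdering A E θ) (h' : IsIdempotentOrdering A E θ') :
    θ = θ' := by
  funext i
  by_contra hne
  obtain ⟨v, hv, hv0⟩ := (h.primitive i).hasEigenvalue.exists_hasEigenvector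
  exact hv0 (((h.primitive i).apply_self v hv).symm.trans
    ((h'.primitive i).apply_other _ hne v hv))

namespace THSystem

variable {K V : Type*} [Field K] [AddCommGroup V] [Module K V] {d : ℕ}

theorem tilde_θ (Φ : THSystem K V d) : Φ.tilde.θ = fun i => Φ.θ i.rev :=
  haveI := Φ.finiteDimensional
  Φ.tilde.θ_spec.eigenvalues_unique (Φ.θ_spec.dual Φ.A_multFree).2

theorem tilde_θs (Φ : THSystem K V d) : Φ.tilde.θs = fun i => Φ.θs i.rev :=
  Φ.star.tilde_θ

/-! ### The last row of the transition matrix -/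

/-- The component in `E_d V` of a vector `q(As) ξ`, where `ξ ∈ E_0 V` and `deg q ≤ d`, depends
only on the coefficient of degree `d`, because `As` raises the top component by one step. -/
theorem E_last_aeval_As (Φ : THSystem K V d) (ζ : V) (hζ : ζ ∈ LinearMap.range (Φ.E 0))
    (q : K[X]) (hq : q.natDegree ≤ d) :
    Φ.E (Fin.last d) (aeval Φ.As q ζ) = q.coeff d • Φ.E (Fin.last d) ((Φ.As ^ d) ζ) := by
  have hpow : ∀ (n : ℕ) (j : Fin (d + 1)), n < j.val → Φ.E j ((Φ.As ^ n) ζ) = 0 := by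
    intro n
    induction n with
    | zero =>
      intro j hj
      obtain ⟨w, rfl⟩ := hζ
      rw [pow_zero, Module.End.one_apply, Φ.E_E_apply, if_neg (fun e => by simp [e] at hj)]
    | succ n ih =>
      intro j hj
      have := (Φ.raise_step n 0 _ ih).1 j hj
      rw [zero_smul, sub_zero] at this
      rwa [pow_succ', Module.End.mul_apply]
  rw [aeval_eq_sum_range' (Nat.lt_succ_of_le hq), LinearMap.sum_apply, map_sum,
    Finset.sum_eq_single d]
  · rw [LinearMap.smul_apply, _root_.map_smul]
  · intro n hn hnd
    rw [LinearMap.smul_apply, _root_.map_smul, hpow n _ (by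
      rw [Finset.mem_range] at hn
      rw [Fin.val_last]
      omega), smul_zero]
  · simp

theorem diffProd_smul_E_last (Φ : THSystem K V d) (ζ : V) (hζ : ζ ∈ LinearMap.range (Φ.E 0))
    (j : Fin (d + 1)) :
    diffProd Φ.θs j • Φ.E (Fin.last d) (Φ.Es j ζ) = Φ.E (Fin.last d) ((Φ.As ^ d) ζ) := by
  have hm : (∏ h ∈ Finset.univ.erase j, (X - C (Φ.θs h))).Monic := monic_prod_X_sub_C _ _
  have hn : (∏ h ∈ Finset.univ.erase j, (X - C (Φ.θs h))).natDegree = d := by simp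
  have h := Φ.E_last_aeval_As ζ hζ _ hn.le
  have hc : (∏ h ∈ Finset.univ.erase j, (X - C (Φ.θs h))).coeff d = 1 := by
    have := hm.coeff_natDegree
    rwa [hn] at this
  rw [hc, one_smul, Φ.aeval_As_eq, Finset.sum_eq_single j] at h
  · rw [← h, _root_.map_smul, eval_prod, diffProd]
    simp
  · intro l _ hl
    rw [eval_prod, Finset.prod_eq_zero (i := l) (by simp [hl]) (by simp), zero_smul]
  · simp

theorem E_last_Es_ne_zero (Φ : THSystem K V d) {ζ : V} (hζ : ζ ∈ LinearMap.range (Φ.E 0))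
    (h0 : ζ ≠ 0) (j : Fin (d + 1)) : Φ.E (Fin.last d) (Φ.Es j ζ) ≠ 0 := by
  intro hj
  -- These components are all proportional, so `E_d Es_0 ζ` would vanish as well, against
  -- `Es_apply_ne_zero` for `Φ*` and the vector `Es_0 ζ`.
  have hz := Φ.diffProd_smul_E_last ζ hζ j
  rw [hj, smul_zero] at hz
  have h1 := Φ.diffProd_smul_E_last ζ hζ 0
  rw [← hz] at h1
  have h2 := (smul_eq_zero.1 h1).resolve_left (diffProd_ne_zero Φ.θs_spec.injective 0)
  exact Φ.star.Es_apply_ne_zero (Φ.Es_mem_star ζ) (Φ.Es_apply_ne_zero hζ h0 0) (Fin.last d) h2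

theorem ell_eq (Φ : THSystem K V d) (j : Fin (d + 1)) :
    Φ.ell j = diffProd Φ.θs 0 / diffProd Φ.θs j := by
  have h := tauPoly_eval_mul_etaPoly_eval Φ.θs 0
  have e : tauPoly Φ.θs ((0 : Fin (d + 1)) : ℕ) = 1 := by simp [tauPoly]
  rw [e, eval_one, one_mul] at h
  rw [ell, tauPoly_eval_mul_etaPoly_eval, ← h]
  rfl

theorem ell_ne_zero (Φ : THSystem K V d) (j : Fin (d + 1)) : Φ.ell j ≠ 0 := by
  rw [ell_eq]
  exact div_ne_zero (diffProd_ne_zero Φ.θs_spec.injective 0)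
    (diffProd_ne_zero Φ.θs_spec.injective j)

theorem ell_zero (Φ : THSystem K V d) : Φ.ell 0 = 1 := by
  rw [ell_eq, div_self (diffProd_ne_zero Φ.θs_spec.injective 0)]

theorem E_Es_eq (Φ : THSystem K V d) (ζ : V) (hζ : ζ ∈ LinearMap.range (Φ.E 0))
    (i j : Fin (d + 1)) : Φ.E i (Φ.Es j ζ) = Φ.P i j • Φ.E i (Φ.Es 0 ζ) := by
  rw [Φ.P_spec ζ hζ j, map_sum, Finset.sum_eq_single i]
  · rw [_root_.map_smul, Φ.E_E_apply, if_pos rfl]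
  · intro l _ hl
    rw [_root_.map_smul, Φ.E_E_apply, if_neg hl.symm, smul_zero]
  · simp

theorem E_Es_zero_ne_zero (Φ : THSystem K V d) (i : Fin (d + 1)) : Φ.E i (Φ.Es 0 Φ.ξ) ≠ 0 :=
  Φ.star.Es_apply_ne_zero (Φ.Es_mem_star Φ.ξ) (Φ.Es_apply_ne_zero Φ.ξ_mem Φ.ξ_ne_zero 0) i

theorem P_last (Φ : THSystem K V d) (j : Fin (d + 1)) : Φ.P (Fin.last d) j = Φ.ell j := by
  have h1 := Φ.diffProd_smul_E_last Φ.ξ Φ.ξ_mem j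
  rw [← Φ.diffProd_smul_E_last Φ.ξ Φ.ξ_mem 0, Φ.E_Es_eq _ Φ.ξ_mem, smul_smul] at h1
  have h2 := smul_left_injective K (Φ.E_Es_zero_ne_zero (Fin.last d)) h1
  rw [ell_eq, eq_div_iff (diffProd_ne_zero Φ.θs_spec.injective j), mul_comm, h2]

/-! ### The transition matrix and the polynomials `s` -/

theorem E_aeval_A (Φ : THSystem K V d) (q : K[X]) (i : Fin (d + 1)) (v : V) :
    Φ.E i (aeval Φ.A q v) = q.eval (Φ.θ i) • Φ.E i v := by
  have h : aeval Φ.A q v = ∑ h, q.eval (Φ.θ h) • Φ.E h v := Φ.star.aeval_As_eq q v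
  rw [h, map_sum, Finset.sum_eq_single i]
  · rw [_root_.map_smul, Φ.E_E_apply, if_pos rfl]
  · intro l _ hl
    rw [_root_.map_smul, Φ.E_E_apply, if_neg hl.symm, smul_zero]
  · simp

theorem aeval_X_mul_apply (A : Module.End K V) (q : K[X]) (v : V) :
    aeval A (X * q) v = A (aeval A q v) := by
  rw [map_mul, aeval_X, Module.End.mul_apply]

theorem aeval_C_mul_apply (A : Module.End K V) (c : K) (q : K[X]) (v : V) :
    aeval A (C c * q) v = c • aeval A q v := by
  rw [map_mul, aeval_C, Module.End.mul_apply, Module.algebraMap_end_apply]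

/-- The polynomial `s_j` in `A` carries `Es_0 ξ` to `Es_j ξ`. -/
theorem aeval_s (Φ : THSystem K V d) (j : Fin (d + 1)) :
    aeval Φ.A (Φ.s j.castSucc) (Φ.Es 0 Φ.ξ) = Φ.Es j Φ.ξ := by
  obtain ⟨n, hn⟩ := j
  obtain ⟨h0, hrec, -⟩ := hessPoly_spec Φ.H Φ.H_isHessenberg
  induction n using Nat.strong_induction_on with
  | _ n ih =>
    cases n with
    | zero =>
      have : Φ.s (Fin.castSucc ⟨0, hn⟩) = 1 := h0
      rw [this, map_one, Module.End.one_apply]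
      rfl
    | succ n =>
      have hnd : n < d := by omega
      have h1 := congrArg (fun q => aeval Φ.A q (Φ.Es 0 Φ.ξ)) (hrec ⟨n, hnd⟩)
      have hH : Φ.A (Φ.Es (Fin.castSucc ⟨n, hnd⟩) Φ.ξ) =
          ∑ i : Fin (d + 1) with i.val ≤ n + 1,
            Φ.H i (Fin.castSucc ⟨n, hnd⟩) • Φ.Es i Φ.ξ := by
        rw [Φ.H_spec _ Φ.ξ_mem, eq_comm]
        refine Finset.sum_subset (Finset.subset_univ _) fun i _ hi => ?_
        rw [(Φ.H_isHessenberg i _).1 (by simpa using hi), zero_smul]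
      have e : (Finset.univ.filter fun i : Fin (d + 1) => i.val ≤ n + 1) =
          insert ⟨n + 1, hn⟩ (Finset.univ.filter fun i : Fin (d + 1) => i.val ≤ n) := by
        ext i
        simp only [Finset.mem_filter, Finset.mem_univ, true_and, Finset.mem_insert, Fin.ext_iff]
        omega
      have hn0 := ih n (by omega) (by omega)
      change aeval Φ.A (hessPoly Φ.H (Fin.castSucc (Fin.castSucc ⟨n, hnd⟩))) _ =
        Φ.Es (Fin.castSucc ⟨n, hnd⟩) Φ.ξ at hn0
      simp only [aeval_X_mul_apply, hn0, hH, map_sum, LinearMap.sum_apply,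
        aeval_C_mul_apply] at h1
      rw [e, Finset.sum_insert (by simp), Finset.sum_insert (by simp)] at h1
      have h2 : ∀ i ∈ Finset.univ.filter (fun i : Fin (d + 1) => i.val ≤ n),
          Φ.H i (Fin.castSucc ⟨n, hnd⟩) •
            aeval Φ.A (hessPoly Φ.H i.castSucc) (Φ.Es 0 Φ.ξ) =
          Φ.H i (Fin.castSucc ⟨n, hnd⟩) • Φ.Es i Φ.ξ := fun i hi => by
        congr 1
        exact ih i.val (by simp at hi; omega) i.isLt
      rw [Finset.sum_congr rfl h2] at h1
      have h3 := add_right_cancel h1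
      have hne : Φ.H ⟨n + 1, hn⟩ (Fin.castSucc ⟨n, hnd⟩) ≠ 0 := (Φ.H_isHessenberg _ _).2 rfl
      exact (smul_right_injective V hne h3).symm

theorem P_eq_eval_s (Φ : THSystem K V d) (i j : Fin (d + 1)) :
    Φ.P i j = (Φ.s j.castSucc).eval (Φ.θ i) := by
  have h := Φ.E_Es_eq Φ.ξ Φ.ξ_mem i j
  rw [← Φ.aeval_s j, Φ.E_aeval_A] at h
  exact (smul_left_injective K (Φ.E_Es_zero_ne_zero i) h).symm

theorem s_last (Φ : THSystem K V d) : Φ.s (Fin.last (d + 1)) = ∏ i, (X - C (Φ.θ i)) := by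
  obtain ⟨-, -, hrec⟩ := hessPoly_spec Φ.H Φ.H_isHessenberg
  obtain ⟨hdeg, hmon⟩ := hessPoly_last Φ.H_isHessenberg
  have hc : (subdiagProd Φ.H)⁻¹ ≠ 0 := inv_ne_zero <|
    Finset.prod_ne_zero_iff.2 fun k _ => (Φ.H_isHessenberg k.succ k.castSucc).2 (by simp)
  have hz : aeval Φ.A (hessPoly Φ.H (Fin.last (d + 1))) (Φ.Es 0 Φ.ξ) = 0 := by
    have h1 := congrArg (fun q => aeval Φ.A q (Φ.Es 0 Φ.ξ)) hrec
    have h2 : ∀ i : Fin (d + 1),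
        aeval Φ.A (hessPoly Φ.H i.castSucc) (Φ.Es 0 Φ.ξ) = Φ.Es i Φ.ξ := Φ.aeval_s
    simp only [aeval_X_mul_apply, map_add, LinearMap.add_apply, map_sum, LinearMap.sum_apply,
      aeval_C_mul_apply, h2] at h1
    rw [Φ.H_spec _ Φ.ξ_mem] at h1
    exact (smul_eq_zero.1 (right_eq_add.1 h1)).resolve_left hc
  have hpd : (∏ i, (X - C (Φ.θ i))).degree = ((d + 1 : ℕ) : WithBot ℕ) := by
    rw [degree_prod]
    simp
  refine eq_of_degree_sub_lt_of_eval_index_eq Finset.univ (v := Φ.θ)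
    Φ.θ_spec.injective.injOn ?_ fun i _ => ?_
  · rw [Finset.card_univ, Fintype.card_fin, ← hdeg]
    refine degree_sub_lt_left (hdeg.trans hpd.symm) hmon.ne_zero ?_
    rw [(monic_prod_X_sub_C _ _).leadingCoeff]
    exact hmon
  · have h1 := Φ.E_aeval_A (Φ.s (Fin.last (d + 1))) i (Φ.Es 0 Φ.ξ)
    rw [show aeval Φ.A (Φ.s (Fin.last (d + 1))) (Φ.Es 0 Φ.ξ) = 0 from hz, map_zero] at h1
    rw [(smul_eq_zero.1 h1.symm).resolve_right (Φ.E_Es_zero_ne_zero i), eval_prod]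
    exact (Finset.prod_eq_zero (Finset.mem_univ i) (by simp)).symm

theorem P_west (Φ : THSystem K V d) : IsWestVandermondeSystemWith Φ.P Φ.θ Φ.s :=
  .of_eq_mul Φ.θ_spec.injective (hessPoly_graded Φ.H_isHessenberg) Φ.s_last
    (fun _ => one_ne_zero) fun i j => by rw [one_mul, Φ.P_eq_eval_s]

theorem t_castSucc (Φ : THSystem K V d) (j : Fin (d + 1)) :
    Φ.t j.castSucc = C (Φ.ell j)⁻¹ * Φ.s j.castSucc := by
  rw [t, Fin.snoc_castSucc]

theorem t_last (Φ : THSystem K V d) : Φ.t (Fin.last (d + 1)) = ∏ i, (X - C (Φ.θ i)) := by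
  rw [t, Fin.snoc_last, s_last]

theorem t_graded (Φ : THSystem K V d) : IsGraded fun i : Fin (d + 1) => Φ.t i.castSucc := by
  have h := hessPoly_graded Φ.H_isHessenberg
  refine ⟨?_, fun i => ?_⟩
  · have h0 : Φ.s (Fin.castSucc 0) = 1 := h.1
    simp only [t_castSucc, h0, ell_zero, inv_one, map_one, mul_one]
  · have hi : (Φ.s i.castSucc).degree = (i.val : WithBot ℕ) := h.2 i
    simp only [t_castSucc, degree_C_mul (inv_ne_zero (Φ.ell_ne_zero i)), hi]

/-! ### The split basis and the matrix `𝒫` -/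

/-- The vector `η_h(A) Es_0 ξ`; for `h ≤ d` it spans `U_h`. -/
noncomputable def splitVec (Φ : THSystem K V d) (h : ℕ) : V := aeval Φ.A (etaPoly Φ.θ h) (Φ.Es 0 Φ.ξ)

theorem splitVec_succ (Φ : THSystem K V d) (k : Fin d) :
    Φ.splitVec (k.val + 1) = (Φ.A - Φ.θ k.castSucc.rev • 1) (Φ.splitVec k.val) := by
  rw [splitVec, show k.val = k.castSucc.val from rfl, etaPoly_succ, map_mul,
    Module.End.mul_apply, splitVec]
  simp [Module.algebraMap_end_apply]

theorem splitVec_mem_U (Φ : THSystem K V d) (h : Fin (d + 1)) : Φ.splitVec h ∈ Φ.U h := by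
  induction h using Fin.induction with
  | zero =>
    have e : Φ.splitVec ((0 : Fin (d + 1)) : ℕ) = Φ.Es 0 Φ.ξ := by simp [splitVec, etaPoly]
    rw [e, mem_U]
    refine ⟨fun j hj => by rw [Φ.Es_Es_apply, if_neg hj.ne'], fun j hj => ?_⟩
    rw [Fin.rev_zero] at hj
    exact absurd hj (not_lt.2 (Fin.le_last j))
  | succ k ih =>
    rw [Fin.val_succ, splitVec_succ]
    exact Φ.raise_mem_U k _ ih

theorem splitVec_ne_zero (Φ : THSystem K V d) (h : Fin (d + 1)) : Φ.splitVec h ≠ 0 := by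
  -- The component of `η_h(A) Es_0 ξ` in `E_0 V` does not vanish when `h ≤ d`, since `θ_0` is a
  -- root of `η_{d+1}` only through its last factor.
  intro h0
  have h1 := Φ.E_aeval_A (etaPoly Φ.θ h) 0 (Φ.Es 0 Φ.ξ)
  rw [show aeval Φ.A (etaPoly Φ.θ h) (Φ.Es 0 Φ.ξ) = 0 from h0, map_zero] at h1
  have h2 := (smul_eq_zero.1 h1.symm).resolve_right (Φ.E_Es_zero_ne_zero 0)
  rw [etaPoly, eval_prod, Finset.prod_eq_zero_iff] at h2
  obtain ⟨k, hk, hk0⟩ := h2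
  rw [eval_sub, eval_X, eval_C, sub_eq_zero] at hk0
  have h3 := congrArg Fin.val (Φ.θ_spec.injective hk0)
  simp only [Finset.mem_filter, Finset.mem_univ, true_and, Fin.val_rev, Fin.val_zero] at hk h3
  omega

theorem lower_splitVec (Φ : THSystem K V d) (k : Fin d) :
    Φ.As (Φ.splitVec (k.val + 1)) =
      Φ.θs k.succ • Φ.splitVec (k.val + 1) + Φ.splitSeq k • Φ.splitVec k.val := by
  obtain ⟨c, hc⟩ := Φ.exists_smul_of_mem_U k.castSucc _ _ (Φ.splitVec_mem_U k.castSucc)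
    (Φ.splitVec_ne_zero _) (Φ.lower_mem_U k _ (Φ.splitVec_mem_U k.succ))
  have h1 := (Φ.existsUnique_split k).choose_spec.1 _ (Φ.splitVec_mem_U k.succ)
  have h2 := Φ.splitVec_ne_zero k.succ
  simp only [Fin.val_succ, Fin.val_castSucc] at hc h1 h2
  rw [Module.End.mul_apply, hc, _root_.map_smul, ← splitVec_succ] at h1
  have h3 : c = Φ.splitSeq k := smul_left_injective K h2 h1
  rw [← h3, ← hc]
  simp

/-- If `φ_{k+1}` were zero then `U_{k+1}` would lie in `Es_{k+1} V`, whose nonzero vectors have a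
nonzero component in `E_d V`. -/
theorem splitSeq_ne_zero (Φ : THSystem K V d) (k : Fin d) : Φ.splitSeq k ≠ 0 := by
  intro h0
  have h1 := Φ.lower_splitVec k
  rw [h0, zero_smul, add_zero] at h1
  have hr : Φ.splitVec (k.val + 1) ∈ LinearMap.range (Φ.Es k.succ) := by
    rw [Φ.θs_spec.range_eq Φ.As_multFree]
    exact Module.End.mem_eigenspace_iff.2 h1
  have hfix : Φ.Es k.succ (Φ.splitVec (k.val + 1)) = Φ.splitVec (k.val + 1) := by
    obtain ⟨w, hw⟩ := hr
    rw [← hw, Φ.Es_Es_apply, if_pos rfl]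
  obtain ⟨c, hc⟩ := Φ.star.exists_smul_eq k.succ Φ.ξ (Φ.splitVec (k.val + 1))
    (Φ.Es_apply_ne_zero Φ.ξ_mem Φ.ξ_ne_zero k.succ)
  change c • Φ.Es k.succ Φ.ξ = Φ.Es k.succ (Φ.splitVec (k.val + 1)) at hc
  have hne := Φ.splitVec_ne_zero k.succ
  rw [Fin.val_succ, ← hfix, ← hc] at hne
  have hE := ((Φ.mem_U _ _).1 (Φ.splitVec_mem_U k.succ)).2 (Fin.last d) (by
    rw [Fin.lt_def, Fin.val_rev, Fin.val_succ, Fin.val_last]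
    omega)
  rw [Fin.val_succ, ← hfix, ← hc, _root_.map_smul] at hE
  refine smul_ne_zero (fun e => hne (by rw [e, zero_smul]))
    (Φ.E_last_Es_ne_zero Φ.ξ_mem Φ.ξ_ne_zero k.succ) hE

/-- The vector `∑_h τ*_h(θ*_j) / (φ_1 ⋯ φ_h) • η_h(A) Es_0 ξ`, which is `p(A, θ*_j) Es_0 ξ`. -/
noncomputable def splitSum (Φ : THSystem K V d) (j : Fin (d + 1)) : V :=
  ∑ h : Fin (d + 1), ((tauPoly Φ.θs h).eval (Φ.θs j) /
    ∏ k : Fin d with k.val < h.val, Φ.splitSeq k) • Φ.splitVec h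

theorem E_splitSum (Φ : THSystem K V d) (i j : Fin (d + 1)) :
    Φ.E i (Φ.splitSum j) = Φ.scriptP i j • Φ.E i (Φ.Es 0 Φ.ξ) := by
  rw [splitSum, map_sum, scriptP, Matrix.of_apply, Finset.sum_smul]
  refine Finset.sum_congr rfl fun h _ => ?_
  rw [_root_.map_smul, splitVec, Φ.E_aeval_A, smul_smul]
  congr 1
  ring

/-- The vector `p(A, θ*_j) Es_0 ξ` is an eigenvector of `As`: in the split basis, `As` is
bidiagonal, and the two contributions to each coefficient cancel. -/
theorem As_splitSum (Φ : THSystem K V d) (j : Fin (d + 1)) :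
    Φ.As (Φ.splitSum j) = Φ.θs j • Φ.splitSum j := by
  set a : Fin (d + 1) → K := fun h => (tauPoly Φ.θs h).eval (Φ.θs j) /
    ∏ k : Fin d with k.val < h.val, Φ.splitSeq k with ha
  have hstep : ∀ k : Fin d, a k.succ * Φ.splitSeq k = a k.castSucc * (Φ.θs j - Φ.θs k.castSucc) := by
    intro k
    have e : (Finset.univ.filter fun l : Fin d => l.val < k.val + 1) =
        insert k (Finset.univ.filter fun l : Fin d => l.val < k.val) := by
      ext l
      simp only [Finset.mem_filter, Finset.mem_univ, true_and, Finset.mem_insert, Fin.ext_iff]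
      omega
    have hp : (∏ l : Fin d with l.val < k.val, Φ.splitSeq l) ≠ 0 :=
      Finset.prod_ne_zero_iff.2 fun l _ => Φ.splitSeq_ne_zero l
    have hk := Φ.splitSeq_ne_zero k
    have ht : tauPoly Φ.θs (k.val + 1) = _ := tauPoly_succ Φ.θs k.castSucc
    simp only [ha, Fin.val_succ, Fin.val_castSucc, e, ht]
    rw [Finset.prod_insert (by simp), eval_mul, eval_sub, eval_X, eval_C]
    field_simp
  have hend : a (Fin.last d) * (Φ.θs j - Φ.θs (Fin.last d)) = 0 := by
    have h1 := tauPoly_eval_eq_zero Φ.θs j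
    have ht : tauPoly Φ.θs (d + 1) = _ := tauPoly_succ Φ.θs (Fin.last d)
    rw [ht, eval_mul, eval_sub, eval_X, eval_C] at h1
    simp only [ha]
    rw [div_mul_eq_mul_div, mul_comm, h1, zero_div]
  have hs : Φ.splitSum j = ∑ h : Fin (d + 1), a h • Φ.splitVec h := rfl
  have h0 : Φ.As (Φ.splitVec 0) = Φ.θs 0 • Φ.splitVec 0 := by
    have e : Φ.splitVec 0 = Φ.Es 0 Φ.ξ := by simp [splitVec, etaPoly]
    rw [e]
    exact Φ.star.A_E_apply 0 Φ.ξ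
  have hAs : Φ.As (Φ.splitSum j) = ∑ h : Fin (d + 1), (a h * Φ.θs h) • Φ.splitVec h +
      ∑ k : Fin d, (a k.succ * Φ.splitSeq k) • Φ.splitVec k := by
    rw [hs, map_sum, Fin.sum_univ_succ, Fin.sum_univ_succ, add_assoc, ← Finset.sum_add_distrib]
    congr 1
    · rw [_root_.map_smul, Fin.val_zero, h0, smul_smul]
    · refine Finset.sum_congr rfl fun k _ => ?_
      rw [_root_.map_smul, Fin.val_succ, lower_splitVec, smul_add, smul_smul, smul_smul]
  have hcast : ∑ k : Fin d, (a k.succ * Φ.splitSeq k) • Φ.splitVec k =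
      ∑ h : Fin (d + 1), (a h * (Φ.θs j - Φ.θs h)) • Φ.splitVec h := by
    rw [Fin.sum_univ_castSucc, hend, zero_smul, add_zero]
    exact Finset.sum_congr rfl fun k _ => by rw [hstep, Fin.val_castSucc]
  rw [hAs, hcast, ← Finset.sum_add_distrib, hs, Finset.smul_sum]
  refine Finset.sum_congr rfl fun h _ => ?_
  rw [← add_smul, smul_smul]
  congr 1
  ring

theorem scriptP_last (Φ : THSystem K V d) (j : Fin (d + 1)) : Φ.scriptP (Fin.last d) j = 1 := by
  rw [scriptP, Matrix.of_apply, Finset.sum_eq_single 0]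
  · simp [etaPoly, tauPoly]
  · intro h _ hh
    rw [etaPoly_eval_last_eq_zero _ (Nat.pos_of_ne_zero fun e => hh (Fin.ext e)), zero_mul,
      zero_div]
  · simp

/-- Both `p(A, θ*_j) Es_0 ξ` and `Es_j ξ` lie in the line `Es_j V`; the factor between them is read
off from their components in `E_d V`. -/
theorem P_eq_ell_mul_scriptP (Φ : THSystem K V d) (i j : Fin (d + 1)) :
    Φ.P i j = Φ.ell j * Φ.scriptP i j := by
  have hfix : Φ.Es j (Φ.splitSum j) = Φ.splitSum j :=
    (Φ.θs_spec.primitive j).apply_self _ (Module.End.mem_eigenspace_iff.2 (Φ.As_splitSum j))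
  obtain ⟨c, hc⟩ := Φ.star.exists_smul_eq j Φ.ξ (Φ.splitSum j)
    (Φ.Es_apply_ne_zero Φ.ξ_mem Φ.ξ_ne_zero j)
  change c • Φ.Es j Φ.ξ = Φ.Es j (Φ.splitSum j) at hc
  rw [hfix] at hc
  have h : ∀ i, c * Φ.P i j = Φ.scriptP i j := fun i => by
    have h1 := Φ.E_splitSum i j
    rw [← hc, _root_.map_smul, Φ.E_Es_eq _ Φ.ξ_mem, smul_smul] at h1
    exact smul_left_injective K (Φ.E_Es_zero_ne_zero i) h1
  have hl := h (Fin.last d)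
  rw [Φ.scriptP_last, Φ.P_last] at hl
  rw [← h i, ← mul_assoc, mul_comm (Φ.ell j), hl, one_mul]

theorem scriptP_eq_mul_inv (Φ : THSystem K V d) : IsUnit Φ.L ∧ Φ.scriptP = Φ.P * Φ.L⁻¹ := by
  have hL : IsUnit Φ.L := by
    rw [L, Matrix.isUnit_diagonal, Pi.isUnit_iff]
    exact fun i => (Φ.ell_ne_zero i).isUnit
  refine ⟨hL, ?_⟩
  have hP : Φ.P = Φ.scriptP * Φ.L := by
    ext i j
    rw [L, Matrix.mul_diagonal, P_eq_ell_mul_scriptP, mul_comm]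
  rw [hP, Matrix.mul_nonsing_inv_cancel_right _ _ ((Matrix.isUnit_iff_isUnit_det _).1 hL)]

theorem scriptP_eq_eval_t (Φ : THSystem K V d) (i j : Fin (d + 1)) :
    Φ.scriptP i j = (Φ.t j.castSucc).eval (Φ.θ i) := by
  rw [t_castSucc, eval_mul, eval_C, ← P_eq_eval_s, P_eq_ell_mul_scriptP,
    inv_mul_cancel_left₀ (Φ.ell_ne_zero j)]

theorem scriptP_west (Φ : THSystem K V d) : IsWestVandermondeSystemWith Φ.scriptP Φ.θ Φ.t :=
  .of_eq_mul Φ.θ_spec.injective Φ.t_graded Φ.t_last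
    (fun _ => one_ne_zero) fun i j => by rw [one_mul, scriptP_eq_eval_t]

/-! ### Duality and the south Vandermonde structure -/

/-- The matrix `𝒫` of `Φ` is the reflection in the antidiagonal of the one of `Φ~*`. Both sides
come from the scalars `f (E_i Es_j ξ)`, where `f` is a functional supported on `Es_d V`: expanding
`Es_j ξ` gives entries of `P`, expanding the transpose of `E_i` at `f` gives those of `P~*`. -/
theorem scriptP_eq_tilde_star (Φ : THSystem K V d) (i j : Fin (d + 1)) :
    Φ.scriptP i j = Φ.tilde.star.scriptP j.rev i.rev := by
  set Ψ := Φ.tilde.star with hΨ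
  set f : Module.Dual K V := Ψ.ξ with hf
  set η : V := Φ.Es 0 Φ.ξ with hη
  have hEs : ∀ v, f (Φ.Es (Fin.last d) v) = f v := by
    obtain ⟨g, hg⟩ := Ψ.ξ_mem
    have hg' : g ∘ₗ Φ.Es (Fin.last d) = f := by rw [hf, ← hg]; rfl
    intro v
    rw [← hg', LinearMap.comp_apply, LinearMap.comp_apply, Φ.Es_Es_apply, if_pos rfl]
  have hηmem : η ∈ LinearMap.range (Φ.star.E 0) := Φ.Es_mem_star Φ.ξ
  have hη0 : η ≠ 0 := Φ.Es_apply_ne_zero Φ.ξ_mem Φ.ξ_ne_zero 0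
  have hlast : f (Φ.E (Fin.last d) η) ≠ 0 := by
    intro h0
    apply Ψ.ξ_ne_zero
    ext v
    have hne := Φ.star.E_last_Es_ne_zero hηmem hη0 (Fin.last d)
    obtain ⟨c, hc⟩ := Φ.star.exists_smul_eq (Fin.last d) _ v hne
    change c • Φ.Es (Fin.last d) (Φ.E (Fin.last d) η) = Φ.Es (Fin.last d) v at hc
    change f v = 0
    rw [← hEs, ← hc, _root_.map_smul, hEs, h0, smul_zero]
  have hdiff : ∀ l, diffProd Φ.θ l * f (Φ.E l η) = diffProd Φ.θ (Fin.last d) *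
      f (Φ.E (Fin.last d) η) := by
    have h1 : ∀ l, diffProd Φ.θ l * f (Φ.E l η) =
        f (Φ.Es (Fin.last d) ((Φ.A ^ d) η)) := fun l => by
      have h := congrArg f (Φ.star.diffProd_smul_E_last η hηmem l)
      change f (diffProd Φ.θ l • Φ.Es (Fin.last d) (Φ.E l η)) = _ at h
      rw [_root_.map_smul, hEs, smul_eq_mul] at h
      exact h
    intro l
    rw [h1, h1]
  have hθs : Ψ.θs = fun l => Φ.θ l.rev := Φ.tilde_θ
  have hell : f (Φ.E i η) = Ψ.ell i.rev * f (Φ.E (Fin.last d) η) := by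
    have hi := diffProd_ne_zero Φ.θ_spec.injective i
    rw [Ψ.ell_eq, hθs, diffProd_rev, diffProd_rev, Fin.rev_rev, Fin.rev_zero,
      div_mul_eq_mul_div, eq_div_iff hi, ← hdiff i, mul_comm]
  have hP : Φ.P i j * f (Φ.E i η) =
      Ψ.P j.rev i.rev * (Φ.P (Fin.last d) j * f (Φ.E (Fin.last d) η)) := by
    have h := LinearMap.congr_fun (Ψ.E_Es_eq f Ψ.ξ_mem j.rev i.rev) Φ.ξ
    have h' : f (Φ.E i.rev.rev (Φ.Es j.rev.rev Φ.ξ)) = Ψ.P j.rev i.rev *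
        f (Φ.E (Fin.rev 0) (Φ.Es j.rev.rev Φ.ξ)) := h
    rw [Fin.rev_rev, Fin.rev_rev, Fin.rev_zero, Φ.E_Es_eq _ Φ.ξ_mem i j,
      Φ.E_Es_eq _ Φ.ξ_mem (Fin.last d) j, _root_.map_smul, _root_.map_smul] at h'
    exact h'
  rw [hell, Φ.P_last, Φ.P_eq_ell_mul_scriptP, Ψ.P_eq_ell_mul_scriptP] at hP
  have hc : Φ.ell j * Ψ.ell i.rev * f (Φ.E (Fin.last d) η) ≠ 0 :=
    mul_ne_zero (mul_ne_zero (Φ.ell_ne_zero j) (Ψ.ell_ne_zero _)) hlast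
  apply mul_left_cancel₀ hc
  linear_combination hP

section South

variable {W : Type*} [AddCommGroup W] [Module K W]

/-- If the matrices `𝒫` of two systems are reflections of each other in the antidiagonal, then the
west structure of one is the south structure of the other, and the diagonal factor `L` between `P`
and `𝒫` only rescales the rows of the rotated matrix. -/
theorem south_of_scriptP_eq (Φ : THSystem K V d) (Ψ : THSystem K W d)
    (hθ : Ψ.θ = fun i => Φ.θs i.rev)
    (h : ∀ i j, Φ.scriptP i j = Ψ.scriptP j.rev i.rev) :
    IsSouthVandermondeSystemWith Φ.P Φ.θs Ψ.t ∧
      IsSouthVandermondeSystemWith Φ.scriptP Φ.θs Ψ.t := by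
  have hlast : Ψ.t (Fin.last (d + 1)) = ∏ i, (X - C (Φ.θs i)) := by
    rw [Ψ.t_last, hθ]
    exact Equiv.prod_comp Fin.revPerm fun i => X - C (Φ.θs i)
  have hev : ∀ i j : Fin (d + 1), Φ.scriptP j.rev i = (Ψ.t j.castSucc).eval (Φ.θs i) := by
    intro i j
    rw [h, Ψ.scriptP_eq_eval_t, hθ, Fin.rev_rev]
    simp only [Fin.rev_rev]
  constructor
  · refine .of_eq_mul Φ.θs_spec.injective Ψ.t_graded hlast Φ.ell_ne_zero fun i j => ?_
    rw [rotateCW, Matrix.of_apply, P_eq_ell_mul_scriptP, hev]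
  · refine .of_eq_mul Φ.θs_spec.injective Ψ.t_graded hlast (fun _ => one_ne_zero) fun i j => ?_
    rw [rotateCW, Matrix.of_apply, hev, one_mul]

end South

/-- The relation between `Φ` and `Φ~*` is symmetric, so it also yields the south structure for
`Φ~*`. -/
theorem south_pair (Φ : THSystem K V d) :
    (IsSouthVandermondeSystemWith Φ.P Φ.θs Φ.tilde.star.t ∧
      IsSouthVandermondeSystemWith Φ.scriptP Φ.θs Φ.tilde.star.t) ∧
    (IsSouthVandermondeSystemWith Φ.tilde.star.P (fun i => Φ.θ i.rev) Φ.t ∧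
      IsSouthVandermondeSystemWith Φ.tilde.star.scriptP (fun i => Φ.θ i.rev) Φ.t) := by
  have hθ : Φ.tilde.star.θs = fun i => Φ.θ i.rev := Φ.tilde_θ
  refine ⟨south_of_scriptP_eq Φ Φ.tilde.star Φ.tilde_θs Φ.scriptP_eq_tilde_star, ?_⟩
  rw [← hθ]
  refine south_of_scriptP_eq Φ.tilde.star Φ ?_ fun i j => ?_
  · simp [hθ]
  · rw [Φ.scriptP_eq_tilde_star, Fin.rev_rev, Fin.rev_rev]

theorem west_tilde (Φ : THSystem K V d) :
    IsWestVandermondeSystemWith Φ.tilde.P (fun i => Φ.θ i.rev) Φ.tilde.s ∧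
      IsWestVandermondeSystemWith Φ.tilde.scriptP (fun i => Φ.θ i.rev) Φ.tilde.t := by
  rw [← Φ.tilde_θ]
  exact ⟨Φ.tilde.P_west, Φ.tilde.scriptP_west⟩

end THSystem

theorem proposition17p3 {K V : Type*} [Field K] [AddCommGroup V] [Module K V] {d : ℕ}
    (Φ : THSystem K V d) :
    -- the west Vandermonde structure of `P` and its relatives
    (IsWestVandermondeSystemWith Φ.P Φ.θ Φ.s ∧
      IsWestVandermondeSystemWith Φ.star.P Φ.θs Φ.star.s ∧
      IsWestVandermondeSystemWith Φ.tilde.P (fun i => Φ.θ i.rev) Φ.tilde.s ∧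
      IsWestVandermondeSystemWith Φ.tilde.star.P (fun i => Φ.θs i.rev) Φ.tilde.star.s) ∧
    -- the south Vandermonde structure of `P` and its relatives
    (IsSouthVandermondeSystemWith Φ.P Φ.θs Φ.tilde.star.t ∧
      IsSouthVandermondeSystemWith Φ.star.P Φ.θ Φ.tilde.t ∧
      IsSouthVandermondeSystemWith Φ.tilde.P (fun i => Φ.θs i.rev) Φ.star.t ∧
      IsSouthVandermondeSystemWith Φ.tilde.star.P (fun i => Φ.θ i.rev) Φ.t) ∧
    -- the matrices `𝒫` are the matrices `P L⁻¹`
    ((IsUnit Φ.L ∧ Φ.scriptP = Φ.P * Φ.L⁻¹) ∧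
      (IsUnit Φ.star.L ∧ Φ.star.scriptP = Φ.star.P * Φ.star.L⁻¹) ∧
      (IsUnit Φ.tilde.L ∧ Φ.tilde.scriptP = Φ.tilde.P * Φ.tilde.L⁻¹) ∧
      (IsUnit Φ.tilde.star.L ∧ Φ.tilde.star.scriptP = Φ.tilde.star.P * Φ.tilde.star.L⁻¹)) ∧
    -- the west Vandermonde structure of `𝒫` and its relatives
    (IsWestVandermondeSystemWith Φ.scriptP Φ.θ Φ.t ∧
      IsWestVandermondeSystemWith Φ.star.scriptP Φ.θs Φ.star.t ∧
      IsWestVandermondeSystemWith Φ.tilde.scriptP (fun i => Φ.θ i.rev) Φ.tilde.t ∧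
      IsWestVandermondeSystemWith Φ.tilde.star.scriptP (fun i => Φ.θs i.rev) Φ.tilde.star.t) ∧
    -- the south Vandermonde structure of `𝒫` and its relatives
    (IsSouthVandermondeSystemWith Φ.scriptP Φ.θs Φ.tilde.star.t ∧
      IsSouthVandermondeSystemWith Φ.star.scriptP Φ.θ Φ.tilde.t ∧
      IsSouthVandermondeSystemWith Φ.tilde.scriptP (fun i => Φ.θs i.rev) Φ.star.t ∧
      IsSouthVandermondeSystemWith Φ.tilde.star.scriptP (fun i => Φ.θ i.rev) Φ.t) ∧
    -- all of these transition matrices are double Vandermonde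
    (IsDoubleVandermonde Φ.P ∧ IsDoubleVandermonde Φ.star.P ∧
      IsDoubleVandermonde Φ.tilde.P ∧ IsDoubleVandermonde Φ.tilde.star.P ∧
      IsDoubleVandermonde Φ.scriptP ∧ IsDoubleVandermonde Φ.star.scriptP ∧
      IsDoubleVandermonde Φ.tilde.scriptP ∧ IsDoubleVandermonde Φ.tilde.star.scriptP) := by
  have h := Φ.south_pair
  have hs := Φ.star.south_pair
  have w := Φ.west_tilde
  have ws := Φ.star.west_tilde
  refine ⟨⟨Φ.P_west, Φ.star.P_west, w.1, ws.1⟩, ⟨h.1.1, hs.1.1, hs.2.1, h.2.1⟩,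
    ⟨Φ.scriptP_eq_mul_inv, Φ.star.scriptP_eq_mul_inv, Φ.tilde.scriptP_eq_mul_inv,
      Φ.tilde.star.scriptP_eq_mul_inv⟩,
    ⟨Φ.scriptP_west, Φ.star.scriptP_west, w.2, ws.2⟩, ⟨h.1.2, hs.1.2, hs.2.2, h.2.2⟩,
    ⟨Φ.P_west.system.1, h.1.1.system.1⟩, ⟨Φ.star.P_west.system.1, hs.1.1.system.1⟩,
    ⟨w.1.system.1, hs.2.1.system.1⟩, ⟨ws.1.system.1, h.2.1.system.1⟩,
    ⟨Φ.scriptP_west.system.1, h.1.2.system.1⟩, ⟨Φ.star.scriptP_west.system.1, hs.1.2.system.1⟩,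
    ⟨w.2.system.1, hs.2.2.system.1⟩, ⟨ws.2.system.1, h.2.2.system.1⟩⟩
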